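/- For integers $\ell\ge 1$ and $n\ge 0$, let $p_{\ell,3}(n)$ denote the number of 2-color partition triples of $n$ in which the second color appears only in parts that are multiples of $\ell$; that is, the number of ordered triples of pairs $(\lambda_i,\mu_i)$, $i=1,2,3$, of partitions of total size $n$, where every part of each $\mu_i$ is a multiple of $\ell$. Equivalently, $$\sum_{n\ge 0}p_{\ell,3}(n)q^n=\prod_{m\ge 1}\frac{1}{(1-q^m)^3(1-q^{\ell m})^3}.$$ **Theorem.** For all integers $n,\alpha,\beta\ge 0$, $$p_{3^{2\alpha+2},3}\left(3^{2\alpha+2\beta+1}n+\frac{2\cdot 3^{2\alpha+2\beta+1}+3^{2\alpha+2}+1}{8}\right)\equiv 0 \pmod{3^{3\alpha+2\beta+2}},$$ $$p_{3^{2\alpha+2},3}\left(3^{2\alpha+2\beta+2}n+\frac{10\cdot 3^{2\alpha+2\beta+1}+3^{2\alpha+2}+1}{8}\right)\equiv 0 \pmod{3^{3\alpha+2\beta+3}},$$ $$p_{3^{2\alpha+2},3}\left(3^{2\alpha+2\beta+3}n+\frac{14\cdot 3^{2\alpha+2\beta+2}+3^{2\alpha+2}+1}{8}\right)\equiv 0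 \pmod{3^{3\alpha+2\beta+6}},$$ $$p_{3^{2\alpha+2},3}\left(3^{2\alpha+2\beta+3}n+\frac{22\cdot 3^{2\alpha+2\beta+2}+3^{2\alpha+2}+1}{8}\right)\equiv 0 \pmod{3^{3\alpha+2\beta+7}}.$$ Moreover, for all integers $n,\alpha,\beta,k\ge 0$ and every prime $p\equiv 3\pmod 4$ with $p\nmid n$, $$p_{3^{2\alpha+2},3}\left(3^{2\alpha+2\beta+1}p^{2k+1}n+\frac{2p^{2k+2}\cdot 3^{2\alpha+2\beta+1}+3^{2\alpha+2}+1}{8}\right)\equiv 0 \pmod{3^{3\alpha+2\beta+4}}.$$ -/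

import Mathlib

/-- A 2-color partition triple of `n` in which the second color appears only in parts that are
multiples of `ℓ`: an ordered triple `t 0, t 1, t 2` of 2-color partitions with total size `n`.
A 2-color partition is a pair of multisets of positive integers, the first one consisting of
the parts of the first color, the second one of the parts of the second color. -/
def IsTwoColorPartitionTriple (ℓ n : ℕ) (t : Fin 3 → Multiset ℕ × Multiset ℕ) : Prop :=
  (∀ i, (∀ a ∈ (t i).1, 0 < a) ∧ (∀ b ∈ (t i).2, 0 < b ∧ ℓ ∣ b)) ∧
    ∑ i, ((t i).1.sum + (t i).2.sum) = n

/-- There are only finitely many such triples, so that counting them by `Set.ncard` is genuine. -/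
theorem finite_setOf_isTwoColorPartitionTriple (ℓ n : ℕ) :
    {t | IsTwoColorPartitionTriple ℓ n t}.Finite := by
  have hS : (⋃ m ∈ Set.Iic n,
      Set.range (fun P : Nat.Partition m => P.parts)).Finite :=
    (Set.finite_Iic n).biUnion fun m _ => Set.finite_range _
  refine (Set.Finite.pi' fun _ : Fin 3 => hS.prod hS).subset ?_
  intro t ht i
  obtain ⟨hpos, hsum⟩ := ht
  have hle : (t i).1.sum + (t i).2.sum ≤ n := by
    rw [← hsum]
    exact Finset.single_le_sum (f := fun i => (t i).1.sum + (t i).2.sum)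
      (fun _ _ => Nat.zero_le _) (Finset.mem_univ i)
  constructor
  · refine Set.mem_biUnion (x := (t i).1.sum) (Set.mem_Iic.2 (by omega)) ?_
    exact ⟨⟨(t i).1, fun {a} ha => (hpos i).1 a ha, rfl⟩, rfl⟩
  · refine Set.mem_biUnion (x := (t i).2.sum) (Set.mem_Iic.2 (by omega)) ?_
    exact ⟨⟨(t i).2, fun {b} hb => ((hpos i).2 b hb).1, rfl⟩, rfl⟩

/-- `p_{ℓ,3}(n)`: the number of 2-color partition triples of `n` in which the second color appears
only in parts that are multiples of `ℓ`. Its generating function is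
`∏_{m ≥ 1} 1 / ((1 - q ^ m) ^ 3 * (1 - q ^ (ℓ * m)) ^ 3)` for `ℓ ≥ 1`. -/
noncomputable def twoColorPartitionTripleCount (ℓ n : ℕ) : ℕ :=
  {t | IsTwoColorPartitionTriple ℓ n t}.ncard

/-! Write E = ∏(1 - q^n) and P = 1/E, so that the counting series is P(q)^3 P(q^ℓ)^3 with ℓ =
3^(2α+2). The argument is 3-adic, with s = q E(q^9)^3/E(q)^3 (`hauptNine`), x = q E(q^3)^12/E(q)^12
(`hauptThree`), and the operator U that keeps the coefficients of index divisible by 3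
(`extractThree`).

Jacobi's series for E^3 gives E^3 = A(q^3) - 3q E(q^9)^3. Its norm over q ↦ ωq, ω^3 = 1, yields s^3
= x(q^3)(1 + 9s + 27s^2), x = s + 9s^2 + 27s^3, and the values U(s), U(s^2). As U is linear over
series in q^3, the cubic becomes a recursion for U(s^c), which bounds the powers of 3 in its
expansion in x (`extractThree_hauptNine_pow_mem`). Hence, on sums of c_k x^(k+1) with 3^(v+2k) ∣
c_k, the map y ↦ U(y s^r), r ≤ 2, raises v by 2 - r (`extractThree_mul_hauptNine_pow_mem`).

Selecting a residue class mod 3 is U after multiplication by a power of q, and q P^3 = s P(q^9)^3.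
The initial section produces 9x, so v = 2. Each of α steps n ↦ 9n + 5 gains 2 + 1 (r = 0, then 1);
each of β steps n ↦ 9n + 2 gains 2 + 0 (r = 0, then 2). The section D then satisfies q D = y
P(q^3)^6 with v = 3α + 2β + 2 (`exists_progression_twoColor`), which is the first congruence. The
others come from the first terms of y: 3-dissecting powers of P shows that some residue classes
carry extra factors 3, and mod 9 the x-term is a multiple of q E^6, whose N-th coefficient vanishes
unless 8N + 2 is a sum of two squares. -/

/-! ### Gaussian binomials and the finite q-binomial theorem. -/

section QBinomial

variable {R : Type*} [CommRing R]

/-- Gaussian binomial coefficients, by the Pascal recursion. -/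
def gaussBinom (q : R) : ℕ → ℕ → R
  | _, 0 => 1
  | 0, _ + 1 => 0
  | m + 1, k + 1 => gaussBinom q m k + q ^ (k + 1) * gaussBinom q m (k + 1)

/-- The finite Euler product `∏_{i ≤ n} (1 - q ^ i)`. -/
def qFactorial (q : R) (n : ℕ) : R := ∏ i ∈ Finset.range n, (1 - q ^ (i + 1))

theorem gaussBinom_succ_succ (q : R) (m k : ℕ) : gaussBinom q (m + 1) (k + 1) =
    gaussBinom q m k + q ^ (k + 1) * gaussBinom q m (k + 1) := rfl

@[simp] theorem gaussBinom_zero_right (q : R) (m : ℕ) : gaussBinom q m 0 = 1 := by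
  cases m <;> rfl

theorem gaussBinom_eq_zero (q : R) {m k : ℕ} (h : m < k) : gaussBinom q m k = 0 := by
  induction m generalizing k with
  | zero => obtain ⟨k, rfl⟩ := Nat.exists_eq_succ_of_ne_zero h.ne'; rfl
  | succ m ih =>
    obtain ⟨k, rfl⟩ := Nat.exists_eq_succ_of_ne_zero (by omega : k ≠ 0)
    simp only [gaussBinom]
    rw [ih (by omega), ih (by omega)]
    ring

theorem qFactorial_succ (q : R) (n : ℕ) :
    qFactorial q (n + 1) = qFactorial q n * (1 - q ^ (n + 1)) :=
  Finset.prod_range_succ _ _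

theorem gaussBinom_mul_qFactorial (q : R) (a b : ℕ) :
    gaussBinom q (a + b) a * (qFactorial q a * qFactorial q b) = qFactorial q (a + b) := by
  induction hn : a + b generalizing a b with
  | zero =>
    obtain rfl : a = 0 := by omega
    obtain rfl : b = 0 := by omega
    simp [qFactorial]
  | succ n ih =>
    rcases a with _ | a
    · obtain rfl : b = n + 1 := by omega
      simp [qFactorial]
    · rcases b with _ | b
      · obtain rfl : a = n := by omega
        have h1 := ih a 0 rfl
        simp only [gaussBinom, gaussBinom_eq_zero q (Nat.lt_succ_self a)]
        simp only [qFactorial_succ] at *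
        linear_combination (1 - q ^ (a + 1)) * h1
      · have h1 := ih a (b + 1) (by omega)
        have h2 := ih (a + 1) b (by omega)
        obtain rfl : n = a + b + 1 := by omega
        rw [gaussBinom_succ_succ]
        simp only [qFactorial_succ] at *
        linear_combination (1 - q ^ (a + 1)) * h1 + q ^ (a + 1) * (1 - q ^ (b + 1)) * h2

/-- The finite `q`-binomial theorem. -/
theorem prod_add_mul_pow (q w z : R) (m : ℕ) :
    ∏ i ∈ Finset.range m, (w + z * q ^ i) =
      ∑ k ∈ Finset.range (m + 1), q ^ (k.choose 2) * gaussBinom q m k * z ^ k * w ^ (m - k) := by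
  induction m generalizing z with
  | zero => simp
  | succ m ih =>
    rw [Finset.prod_range_succ']
    have : ∀ i, w + z * q ^ (i + 1) = w + (z * q) * q ^ i := fun i => by ring
    simp only [this]
    rw [ih, Finset.sum_range_succ' _ (m + 1), Finset.sum_mul]
    have h1 : ∀ k ∈ Finset.range (m + 1),
        q ^ ((k + 1).choose 2) * gaussBinom q (m + 1) (k + 1) * z ^ (k + 1) * w ^ (m + 1 - (k + 1))
        = q ^ (k.choose 2) * gaussBinom q m k * (z * q) ^ k * w ^ (m - k) * z +
          q ^ ((k + 1).choose 2) * gaussBinom q m (k + 1) * (z * q) ^ (k + 1) * w ^ (m - k) := by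
      intro k _
      rw [Nat.choose_succ_succ' k 1, Nat.choose_one_right, gaussBinom, Nat.succ_sub_succ, mul_pow,
        mul_pow]
      ring
    rw [Finset.sum_congr rfl h1, Finset.sum_add_distrib]
    have h2 : ∀ k ∈ Finset.range (m + 1),
        q ^ (k.choose 2) * gaussBinom q m k * (z * q) ^ k * w ^ (m - k) * (w + z * q ^ 0)
        = q ^ (k.choose 2) * gaussBinom q m k * (z * q) ^ k * w ^ (m - k) * z +
          q ^ (k.choose 2) * gaussBinom q m k * (z * q) ^ k * w ^ (m + 1 - k) := by
      intro k hk
      rw [Nat.succ_sub (by simpa [Nat.lt_succ_iff] using hk), pow_succ w]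
      ring
    rw [Finset.sum_congr rfl h2, Finset.sum_add_distrib, add_assoc]
    congr 1
    rw [Finset.sum_range_succ' _ m, Finset.sum_range_succ _ m,
      gaussBinom_eq_zero q (Nat.lt_succ_self m)]
    simp

open Polynomial in
theorem gaussBinom_C (q : R) (m k : ℕ) : gaussBinom (C q) m k = C (gaussBinom q m k) := by
  induction m generalizing k with
  | zero => cases k <;> simp [gaussBinom]
  | succ m ih => cases k <;> simp [gaussBinom, ih]

open Polynomial in
/-- The derivative of the finite `q`-binomial theorem at a zero of the product. -/
theorem sum_mul_gaussBinom (q : R) (N : ℕ) :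
    ∑ k ∈ Finset.range (2 * N + 2),
      q ^ (k.choose 2 + N * (2 * N + 1 - k)) * gaussBinom q (2 * N + 1) k * (-1) ^ k * k =
    -(-1) ^ N * q ^ (N + N.choose 2 + N * N) * qFactorial q N ^ 2 := by
  have h := congrArg (fun p : R[X] => (derivative p).eval 1)
    (prod_add_mul_pow (C q) (C q ^ N) (-X) (2 * N + 1))
  have hr : ∑ k ∈ Finset.range (2 * N + 1 + 1), C q ^ (k.choose 2) *
      gaussBinom (C q) (2 * N + 1) k * (-X) ^ k * (C q ^ N) ^ (2 * N + 1 - k) =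
      ∑ k ∈ Finset.range (2 * N + 2), C (q ^ (k.choose 2 + N * (2 * N + 1 - k)) *
        gaussBinom q (2 * N + 1) k * (-1) ^ k) * X ^ k := by
    refine Finset.sum_congr rfl fun k _ => ?_
    rw [gaussBinom_C, neg_pow (X : R[X])]
    simp only [map_mul, map_pow, map_neg, map_one]
    ring
  -- The factor of index N is q^N (1 - X); it is isolated because at X = 1 the product rule leaves
  -- only its derivative.
  have hl : ∏ x ∈ Finset.range (2 * N + 1), (C q ^ N + -X * C q ^ x) =
      (1 - X) * (C q ^ N * ((∏ x ∈ Finset.range N, (C q ^ N + -X * C q ^ x)) *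
        ∏ x ∈ Finset.range N, (C q ^ N + -X * C q ^ (N + 1 + x)))) := by
    rw [show 2 * N + 1 = N + 1 + N by ring, Finset.prod_range_add, Finset.prod_range_succ]
    ring
  rw [hl, hr, derivative_mul] at h
  simp only [eval_add, eval_mul, eval_sub, eval_one, eval_X, sub_self, zero_mul, add_zero,
    eval_pow, eval_C, eval_prod, derivative_sub, derivative_one, derivative_X, zero_sub, eval_neg,
    derivative_sum, eval_finsetSum, derivative_C_mul, derivative_X_pow, one_pow, mul_one] at h
  rw [← h]
  have h1 : ∏ x ∈ Finset.range N, (q ^ N + -1 * q ^ x) =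
      (-1) ^ N * q ^ (N.choose 2) * qFactorial q N := by
    have e : ∀ n ≤ N, ∏ x ∈ Finset.range n, (q ^ N + -1 * q ^ x) =
        (-1) ^ n * q ^ (n.choose 2) * ∏ x ∈ Finset.range n, (1 - q ^ (N - x)) := by
      intro n
      induction n with
      | zero => simp
      | succ n ih =>
        intro hn
        obtain ⟨d, rfl⟩ := Nat.exists_eq_add_of_le (Nat.le_of_succ_le hn)
        rw [Finset.prod_range_succ, Finset.prod_range_succ, ih (by omega),
          Nat.choose_succ_succ' n 1, Nat.choose_one_right, Nat.add_sub_cancel_left]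
        ring
    rw [e N le_rfl, qFactorial, ← Finset.prod_range_reflect (fun i => 1 - q ^ (i + 1))]
    congr 1
    refine Finset.prod_congr rfl fun i hi => ?_
    rw [Finset.mem_range] at hi
    congr 2
    omega
  have h2 : ∏ x ∈ Finset.range N, (q ^ N + -1 * q ^ (N + 1 + x)) =
      q ^ (N * N) * qFactorial q N := by
    rw [qFactorial, pow_mul, show (q ^ N) ^ N = ∏ _x ∈ Finset.range N, q ^ N by simp,
      ← Finset.prod_mul_distrib]
    exact Finset.prod_congr rfl fun i _ => by ring
  rw [h1, h2]
  ring

end QBinomial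

/-! ### Euler's product and its inverse. -/

open PowerSeries PowerSeries.WithPiTopology

/-- Euler's product `∏ (1 - q ^ n)`. -/
noncomputable def eulerProd : ℤ⟦X⟧ := ∏' n : ℕ, (1 - X ^ (n + 1))

/-- The generating function of the partition numbers. -/
noncomputable def partitionSeries : ℤ⟦X⟧ :=
  PowerSeries.mk fun n => (Nat.card (Nat.Partition n) : ℤ)

theorem hasProd_eulerProd : HasProd (fun n : ℕ => (1 - X ^ (n + 1) : ℤ⟦X⟧)) eulerProd :=
  (multipliable_one_sub_X_pow ℤ).hasProd

theorem partitionSeries_mul_eulerProd : partitionSeries * eulerProd = 1 := by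
  have h := Nat.Partition.hasProd_powerSeriesMk_card_restricted ℤ (fun _ => True)
  have h2 := h.mul hasProd_eulerProd
  have e : (PowerSeries.mk fun n => ((Nat.Partition.restricted n fun _ => True).card : ℤ))
      = partitionSeries := by
    ext n
    simp [partitionSeries, Nat.Partition.restricted, Nat.card_eq_fintype_card, Finset.card_univ]
  rw [e] at h2
  refine h2.unique ?_
  convert hasProd_one with i
  simp only [if_true, pow_mul]
  exact tsum_pow_mul_one_sub_of_constantCoeff_eq_zero (by simp)

/-! ### Generating function of the partition triples. -/

/-- The generating function of a type with respect to a size. -/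
noncomputable def sizeSeries {A : Type*} (w : A → ℕ) : ℤ⟦X⟧ :=
  PowerSeries.mk fun n => (Nat.card {a // w a = n} : ℤ)

theorem sizeSeries_congr {A B : Type*} (e : A ≃ B) (v : A → ℕ) (w : B → ℕ)
    (h : ∀ a, w (e a) = v a) : sizeSeries v = sizeSeries w := by
  ext n
  simp only [sizeSeries, coeff_mk, Nat.cast_inj]
  exact Nat.card_congr (e.subtypeEquiv fun a => by rw [h])

theorem sizeSeries_prod {A B : Type*} (v : A → ℕ) (w : B → ℕ)
    (hv : ∀ n, Finite {a // v a = n}) (hw : ∀ n, Finite {b // w b = n}) :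
    sizeSeries (fun p : A × B => v p.1 + w p.2) = sizeSeries v * sizeSeries w := by
  ext n
  simp only [sizeSeries, coeff_mk, coeff_mul]
  let e : {p : A × B // v p.1 + w p.2 = n} ≃
      Σ i : (Finset.HasAntidiagonal.antidiagonal n : Finset (ℕ × ℕ)), {a // v a = i.1.1} × {b // w b = i.1.2} :=
    { toFun := fun p => ⟨⟨(v p.1.1, w p.1.2), by simpa using p.2⟩, ⟨p.1.1, rfl⟩, ⟨p.1.2, rfl⟩⟩
      invFun := fun q => ⟨(q.2.1.1, q.2.2.1), by
        rw [q.2.1.2, q.2.2.2]; exact Finset.HasAntidiagonal.mem_antidiagonal.1 q.1.2⟩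
      left_inv := fun p => rfl
      right_inv := by
        rintro ⟨⟨⟨i, j⟩, h⟩, ⟨a, ha⟩, ⟨b, hb⟩⟩
        dsimp only at ha hb
        subst ha hb
        rfl }
  rw [Nat.card_congr e, Nat.card_sigma]
  push_cast [Nat.card_prod]
  exact Finset.sum_coe_sort (Finset.HasAntidiagonal.antidiagonal n)
    (fun i => (Nat.card {a // v a = i.1} : ℤ) * (Nat.card {b // w b = i.2} : ℤ))

theorem finite_prod_size {A B : Type*} (v : A → ℕ) (w : B → ℕ)
    (hv : ∀ n, Finite {a // v a = n}) (hw : ∀ n, Finite {b // w b = n}) (n : ℕ) :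
    Finite {p : A × B // v p.1 + w p.2 = n} := by
  have h1 : {p : A × B | v p.1 + w p.2 = n} ⊆
      (⋃ i ∈ Set.Iic n, {a | v a = i}) ×ˢ (⋃ i ∈ Set.Iic n, {b | w b = i}) := by
    rintro ⟨a, b⟩ h
    simp only [Set.mem_ofPred_eq] at h
    constructor <;> simp <;> omega
  refine Set.Finite.subset (Set.Finite.prod ?_ ?_) h1
  · exact (Set.finite_Iic n).biUnion fun i _ => hv i
  · exact (Set.finite_Iic n).biUnion fun i _ => hw i

/-- Partitions of arbitrary integers into multiples of `ℓ`. -/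
abbrev MultiplePartition (ℓ : ℕ) : Type := {s : Multiset ℕ // ∀ b ∈ s, 0 < b ∧ ℓ ∣ b}

theorem nonempty_partitionEquiv (n : ℕ) :
    Nonempty ({s : {s : Multiset ℕ // ∀ a ∈ s, 0 < a} // s.1.sum = n} ≃ Nat.Partition n) :=
  ⟨{ toFun := fun s => ⟨s.1.1, fun {i} hi => s.1.2 i hi, s.2⟩
     invFun := fun p => ⟨⟨p.parts, fun _ ha => p.parts_pos ha⟩, p.parts_sum⟩
     left_inv := fun _ => rfl
     right_inv := fun _ => rfl }⟩

theorem sizeSeries_partition :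
    sizeSeries (fun s : {s : Multiset ℕ // ∀ a ∈ s, 0 < a} => s.1.sum) = partitionSeries := by
  ext n
  simp only [sizeSeries, partitionSeries, coeff_mk]
  rw [Nat.card_congr (nonempty_partitionEquiv n).some]

theorem finite_partition_size (n : ℕ) :
    Finite {s : {s : Multiset ℕ // ∀ a ∈ s, 0 < a} // s.1.sum = n} :=
  Finite.of_equiv _ (nonempty_partitionEquiv n).some.symm

/-- Multiplying all parts by `ℓ`. -/
noncomputable def scaleParts {ℓ : ℕ} (hℓ : ℓ ≠ 0) :
    {s : Multiset ℕ // ∀ a ∈ s, 0 < a} ≃ MultiplePartition ℓ where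
  toFun s := ⟨s.1.map (ℓ * ·), by
    intro b hb
    obtain ⟨a, ha, rfl⟩ := Multiset.mem_map.1 hb
    exact ⟨Nat.mul_pos (Nat.pos_of_ne_zero hℓ) (s.2 a ha), dvd_mul_right _ _⟩⟩
  invFun s := ⟨s.1.map (· / ℓ), by
    intro b hb
    obtain ⟨a, ha, rfl⟩ := Multiset.mem_map.1 hb
    exact Nat.div_pos (Nat.le_of_dvd (s.2 a ha).1 (s.2 a ha).2) (Nat.pos_of_ne_zero hℓ)⟩
  left_inv s := by
    ext1
    simp [Multiset.map_map, Nat.mul_div_cancel_left _ (Nat.pos_of_ne_zero hℓ)]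
  right_inv s := by
    ext1
    simp only [Multiset.map_map]
    conv_rhs => rw [← Multiset.map_id s.1]
    refine Multiset.map_congr rfl fun a ha => ?_
    simpa using Nat.mul_div_cancel' (s.2 a ha).2

theorem sum_scaleParts {ℓ : ℕ} (hℓ : ℓ ≠ 0) (s : {s : Multiset ℕ // ∀ a ∈ s, 0 < a}) :
    (scaleParts hℓ s).1.sum = ℓ * s.1.sum := by
  simpa [scaleParts] using Multiset.sum_map_mul_left (s := s.1) (f := id)

theorem finite_multiplePartition_size {ℓ : ℕ} (n : ℕ) :
    Finite {s : MultiplePartition ℓ // s.1.sum = n} := by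
  have := finite_partition_size n
  refine Finite.of_injective (β := {s : {s : Multiset ℕ // ∀ a ∈ s, 0 < a} // s.1.sum = n})
    (fun s => ⟨⟨s.1.1, fun a ha => (s.1.2 a ha).1⟩, s.2⟩) ?_
  intro s t h
  simp only [Subtype.mk.injEq] at h
  exact Subtype.ext (Subtype.ext h)

theorem sizeSeries_multiplePartition {ℓ : ℕ} (hℓ : ℓ ≠ 0) :
    sizeSeries (fun s : MultiplePartition ℓ => s.1.sum) = expand ℓ hℓ partitionSeries := by
  rw [← sizeSeries_congr (scaleParts hℓ) (fun s => ℓ * s.1.sum) _ (sum_scaleParts hℓ),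
    ← sizeSeries_partition]
  ext n
  rw [coeff_expand]
  simp only [sizeSeries, coeff_mk]
  split_ifs with h
  · obtain ⟨m, rfl⟩ := h
    rw [Nat.mul_div_cancel_left _ (Nat.pos_of_ne_zero hℓ)]
    simp [hℓ]
  · rw [Nat.cast_eq_zero]
    have : IsEmpty {s : {s : Multiset ℕ // ∀ a ∈ s, 0 < a} // ℓ * s.1.sum = n} :=
      ⟨fun s => h ⟨_, s.2.symm⟩⟩
    exact Nat.card_of_isEmpty

/-- Six-fold product form of the triples of two-color partitions. -/
def tripleEquiv (ℓ n : ℕ) :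
    {t // IsTwoColorPartitionTriple ℓ n t} ≃
    {p : ({s : Multiset ℕ // ∀ a ∈ s, 0 < a} × MultiplePartition ℓ) ×
      ({s : Multiset ℕ // ∀ a ∈ s, 0 < a} × MultiplePartition ℓ) ×
      ({s : Multiset ℕ // ∀ a ∈ s, 0 < a} × MultiplePartition ℓ) //
      (p.1.1.1.sum + p.1.2.1.sum) + ((p.2.1.1.1.sum + p.2.1.2.1.sum) +
        (p.2.2.1.1.sum + p.2.2.2.1.sum)) = n} where
  toFun t := ⟨((⟨_, (t.2.1 0).1⟩, ⟨_, (t.2.1 0).2⟩), (⟨_, (t.2.1 1).1⟩, ⟨_, (t.2.1 1).2⟩),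
    (⟨_, (t.2.1 2).1⟩, ⟨_, (t.2.1 2).2⟩)), by
      have := t.2.2
      rw [Fin.sum_univ_three] at this
      simp only
      omega⟩
  invFun p := ⟨![(p.1.1.1.1, p.1.1.2.1), (p.1.2.1.1.1, p.1.2.1.2.1),
      (p.1.2.2.1.1, p.1.2.2.2.1)], by
      refine ⟨fun i => ?_, ?_⟩
      · fin_cases i
        · exact ⟨p.1.1.1.2, p.1.1.2.2⟩
        · exact ⟨p.1.2.1.1.2, p.1.2.1.2.2⟩
        · exact ⟨p.1.2.2.1.2, p.1.2.2.2.2⟩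
      · have := p.2
        rw [Fin.sum_univ_three]
        simp only [Matrix.cons_val_zero, Matrix.cons_val_one, Matrix.cons_val]
        omega⟩
  left_inv t := by
    ext1
    funext i
    fin_cases i <;> rfl
  right_inv p := rfl

theorem mk_twoColorPartitionTripleCount {ℓ : ℕ} (hℓ : ℓ ≠ 0) :
    PowerSeries.mk (fun n => (twoColorPartitionTripleCount ℓ n : ℤ)) =
      partitionSeries ^ 3 * expand ℓ hℓ partitionSeries ^ 3 := by
  have hf := finite_prod_size _ _ finite_partition_size (finite_multiplePartition_size (ℓ := ℓ))
  have h1 := sizeSeries_prod _ _ finite_partition_size (finite_multiplePartition_size (ℓ := ℓ))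
  have h2 := sizeSeries_prod _ _ hf (finite_prod_size _ _ hf hf)
  rw [sizeSeries_prod _ _ hf hf, h1, sizeSeries_partition, sizeSeries_multiplePartition hℓ] at h2
  rw [show partitionSeries ^ 3 * expand ℓ hℓ partitionSeries ^ 3 =
    partitionSeries * expand ℓ hℓ partitionSeries * (partitionSeries * expand ℓ hℓ partitionSeries *
      (partitionSeries * expand ℓ hℓ partitionSeries)) by ring, ← h2]
  ext n
  simp only [sizeSeries, coeff_mk, Nat.cast_inj]
  rw [twoColorPartitionTripleCount, ← Nat.card_coe_set_eq]
  exact Nat.card_congr (tripleEquiv ℓ n)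

/-! ### Jacobi's identity for the cube of Euler's product. -/

theorem sum_range_fold {M : Type*} [AddCommMonoid M] (g : ℕ → M) (N : ℕ) :
    ∑ k ∈ Finset.range (2 * N + 2), g k =
      ∑ n ∈ Finset.range (N + 1), (g (N - n) + g (N + 1 + n)) := by
  rw [show 2 * N + 2 = N + 1 + (N + 1) by ring, Finset.sum_range_add, Finset.sum_add_distrib,
    ← Finset.sum_range_reflect g]
  congr 1

/-- With `choose_two_add_add`: the terms k = N - n and k = N + 1 + n of `sum_mul_gaussBinom` carry
the same power of q. -/
theorem choose_two_add_sub (N n : ℕ) (h : n ≤ N) :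
    (N - n).choose 2 + N * (2 * N + 1 - (N - n)) = (N + N.choose 2 + N * N) + (n + 1).choose 2 := by
  obtain ⟨d, rfl⟩ := Nat.exists_eq_add_of_le h
  have e1 : 2 * (n + d) + 1 - d = 2 * n + d + 1 := by omega
  rw [Nat.add_sub_cancel_left, e1]
  have h2 : ∀ m : ℕ, (2 * (m.choose 2 : ℕ) : ℚ) = m * (m - 1) := by
    intro m
    rw [Nat.cast_choose_two]
    ring
  have h3 := h2 d
  have h4 := h2 (n + d)
  have h5 := h2 (n + 1)
  push_cast at h3 h4 h5
  have : ((d.choose 2 + (n + d) * (2 * n + d + 1) : ℕ) : ℚ) =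
      (((n + d) + (n + d).choose 2 + (n + d) * (n + d) + (n + 1).choose 2 : ℕ) : ℚ) := by
    push_cast
    linear_combination h3 / 2 - h4 / 2 - h5 / 2
  exact_mod_cast this

theorem choose_two_add_add (N n : ℕ) (h : n ≤ N) :
    (N + 1 + n).choose 2 + N * (2 * N + 1 - (N + 1 + n)) =
      (N + N.choose 2 + N * N) + (n + 1).choose 2 := by
  obtain ⟨d, rfl⟩ := Nat.exists_eq_add_of_le h
  have e1 : 2 * (n + d) + 1 - (n + d + 1 + n) = d := by omega
  rw [e1]
  have h2 : ∀ m : ℕ, (2 * (m.choose 2 : ℕ) : ℚ) = m * (m - 1) := by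
    intro m
    rw [Nat.cast_choose_two]
    ring
  have h3 := h2 (n + d + 1 + n)
  have h4 := h2 (n + d)
  have h5 := h2 (n + 1)
  push_cast at h3 h4 h5
  have : (((n + d + 1 + n).choose 2 + (n + d) * d : ℕ) : ℚ) =
      (((n + d) + (n + d).choose 2 + (n + d) * (n + d) + (n + 1).choose 2 : ℕ) : ℚ) := by
    push_cast
    linear_combination h3 / 2 - h4 / 2 - h5 / 2
  exact_mod_cast this


theorem qFactorial_X_ne_zero (n : ℕ) : qFactorial (X : ℤ⟦X⟧) n ≠ 0 := by
  intro h
  have := congrArg constantCoeff h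
  simp [qFactorial, map_prod] at this

theorem gaussBinom_symm_X (N n : ℕ) (h : n ≤ N) :
    gaussBinom (X : ℤ⟦X⟧) (2 * N + 1) (N + 1 + n) = gaussBinom X (2 * N + 1) (N - n) := by
  have h1 := gaussBinom_mul_qFactorial (X : ℤ⟦X⟧) (N - n) (N + 1 + n)
  have h2 := gaussBinom_mul_qFactorial (X : ℤ⟦X⟧) (N + 1 + n) (N - n)
  rw [show N - n + (N + 1 + n) = 2 * N + 1 by omega] at h1
  rw [show N + 1 + n + (N - n) = 2 * N + 1 by omega, ← h1] at h2
  refine mul_right_cancel₀ (mul_ne_zero (qFactorial_X_ne_zero (N + 1 + n))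
    (qFactorial_X_ne_zero (N - n))) ?_
  rw [h2]
  ring

/-- Folding `sum_mul_gaussBinom` under k ↔ 2N + 1 - k pairs terms of opposite sign and equal
Gaussian binomial; the weights k combine to (N + 1 + n) - (N - n) = 2n + 1. -/
theorem finite_jacobi (N : ℕ) :
    ∑ n ∈ Finset.range (N + 1), (-1) ^ n * (2 * (n : ℤ⟦X⟧) + 1) * (X : ℤ⟦X⟧) ^ ((n + 1).choose 2) *
      gaussBinom X (2 * N + 1) (N - n) = qFactorial X N ^ 2 := by
  have h := sum_mul_gaussBinom (X : ℤ⟦X⟧) N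
  rw [sum_range_fold] at h
  have hX : -(-1) ^ N * (X : ℤ⟦X⟧) ^ (N + N.choose 2 + N * N) ≠ 0 :=
    mul_ne_zero (by simp) (pow_ne_zero _ X_ne_zero)
  apply mul_left_cancel₀ hX
  rw [← h, Finset.mul_sum]
  refine Finset.sum_congr rfl fun n hn => ?_
  have hn' : n ≤ N := by simpa [Nat.lt_succ_iff] using hn
  rw [choose_two_add_sub N n hn', choose_two_add_add N n hn', gaussBinom_symm_X N n hn']
  obtain ⟨d, rfl⟩ := Nat.exists_eq_add_of_le hn'
  rw [Nat.add_sub_cancel_left]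
  push_cast
  have hs : (-1 : ℤ⟦X⟧) ^ (n * 2) = 1 := Even.neg_one_pow ⟨n, by ring⟩
  ring_nf
  rw [hs]
  ring

theorem X_pow_dvd_qFactorial_sub (n m : ℕ) (h : n ≤ m) :
    (X : ℤ⟦X⟧) ^ (n + 1) ∣ qFactorial X m - qFactorial X n := by
  induction m, h using Nat.le_induction with
  | base => simp
  | succ m hm ih =>
    rw [qFactorial_succ, show qFactorial X m * (1 - X ^ (m + 1)) - qFactorial X n =
      (qFactorial X m - qFactorial X n) - qFactorial (X : ℤ⟦X⟧) m * X ^ (m + 1) by ring]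
    exact dvd_sub ih (dvd_mul_of_dvd_right (pow_dvd_pow _ (by omega)) _)

theorem X_pow_dvd_eulerProd_sub (n : ℕ) :
    (X : ℤ⟦X⟧) ^ (n + 1) ∣ eulerProd - qFactorial X n := by
  rw [X_pow_dvd_iff]
  intro k hk
  have h1 := (tendsto_iff_coeff_tendsto ℤ _ _ _).1 hasProd_eulerProd.tendsto_prod_nat k
  have h2 : Filter.Tendsto (fun m => coeff k (qFactorial (X : ℤ⟦X⟧) m)) Filter.atTop
      (nhds (coeff k (qFactorial (X : ℤ⟦X⟧) n))) := by
    refine tendsto_atTop_of_eventually_const (i₀ := n) fun m hm => ?_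
    have := X_pow_dvd_iff.1 (X_pow_dvd_qFactorial_sub n m hm) k hk
    rwa [map_sub, sub_eq_zero] at this
  rw [map_sub, sub_eq_zero]
  exact tendsto_nhds_unique h1 h2

/-- The three q-factorials expressing the Gaussian binomial G all agree with E to this order, so G
E^2 ≡ E, and one E is cancelled by P. -/
theorem X_pow_dvd_eulerProd_mul_gaussBinom_sub (N n : ℕ) (h : n ≤ N) :
    (X : ℤ⟦X⟧) ^ (N - n + 1) ∣ eulerProd * gaussBinom X (2 * N + 1) (N - n) - 1 := by
  have h1 := gaussBinom_mul_qFactorial (X : ℤ⟦X⟧) (N - n) (N + 1 + n)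
  rw [show N - n + (N + 1 + n) = 2 * N + 1 by omega] at h1
  have key : ∀ m, N - n ≤ m → (X : ℤ⟦X⟧) ^ (N - n + 1) ∣ eulerProd - qFactorial X m :=
    fun m hm => (pow_dvd_pow _ (by omega)).trans (X_pow_dvd_eulerProd_sub m)
  obtain ⟨u, hu⟩ := key (N - n) le_rfl
  obtain ⟨v, hv⟩ := key (N + 1 + n) (by omega)
  obtain ⟨w, hw⟩ := key (2 * N + 1) (by omega)
  set G := gaussBinom (X : ℤ⟦X⟧) (2 * N + 1) (N - n)
  have hP := partitionSeries_mul_eulerProd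
  refine ⟨partitionSeries * (G * u * qFactorial X (N + 1 + n) + G * eulerProd * v - w), ?_⟩
  linear_combination (1 - eulerProd * G) * hP + partitionSeries * (G * qFactorial X (N + 1 + n) * hu
    + G * eulerProd * hv - hw + h1)

theorem X_pow_dvd_eulerProd_cube_sub (N : ℕ) :
    (X : ℤ⟦X⟧) ^ (N + 1) ∣ eulerProd ^ 3 -
      ∑ n ∈ Finset.range (N + 1), (-1) ^ n * (2 * (n : ℤ⟦X⟧) + 1) * X ^ ((n + 1).choose 2) := by
  have h1 : (X : ℤ⟦X⟧) ^ (N + 1) ∣ eulerProd ^ 3 - eulerProd * qFactorial X N ^ 2 := by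
    rw [show eulerProd ^ 3 - eulerProd * qFactorial X N ^ 2 =
      (eulerProd - qFactorial X N) * (eulerProd * (eulerProd + qFactorial X N)) by ring]
    exact dvd_mul_of_dvd_left (X_pow_dvd_eulerProd_sub N) _
  have h2 : (X : ℤ⟦X⟧) ^ (N + 1) ∣ eulerProd * qFactorial X N ^ 2 -
      ∑ n ∈ Finset.range (N + 1), (-1) ^ n * (2 * (n : ℤ⟦X⟧) + 1) * X ^ ((n + 1).choose 2) := by
    rw [← finite_jacobi, Finset.mul_sum, ← Finset.sum_sub_distrib]
    refine Finset.dvd_sum fun n hn => ?_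
    have hn' : n ≤ N := by simpa [Nat.lt_succ_iff] using hn
    rw [show eulerProd * ((-1) ^ n * (2 * (n : ℤ⟦X⟧) + 1) * (X : ℤ⟦X⟧) ^ ((n + 1).choose 2) *
      gaussBinom X (2 * N + 1) (N - n)) - (-1) ^ n * (2 * (n : ℤ⟦X⟧) + 1) * X ^ ((n + 1).choose 2) =
      (-1) ^ n * (2 * (n : ℤ⟦X⟧) + 1) * (X ^ ((n + 1).choose 2) *
        (eulerProd * gaussBinom X (2 * N + 1) (N - n) - 1)) by ring]
    refine dvd_mul_of_dvd_right ?_ _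
    refine dvd_trans ?_ (mul_dvd_mul_left _ (X_pow_dvd_eulerProd_mul_gaussBinom_sub N n hn'))
    -- The n orders missing from N - n + 1 are supplied by the triangular exponent, which is at
    -- least n.
    rw [← pow_add]
    refine pow_dvd_pow _ ?_
    rw [Nat.choose_succ_succ' n 1, Nat.choose_one_right]
    omega
  simpa using dvd_add h1 h2

theorem choose_two_strictMono : StrictMono fun n : ℕ => (n + 1).choose 2 :=
  strictMono_nat_of_lt_succ fun n => by
    have : (n + 1 + 1).choose 2 = n + 1 + (n + 1).choose 2 := by
      rw [Nat.choose_succ_succ' (n + 1) 1, Nat.choose_one_right]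
    omega

theorem coeff_term_jacobi (n m : ℕ) :
    coeff m ((-1) ^ n * (2 * (n : ℤ⟦X⟧) + 1) * (X : ℤ⟦X⟧) ^ ((n + 1).choose 2)) =
      if m = (n + 1).choose 2 then (-1) ^ n * (2 * (n : ℤ) + 1) else 0 := by
  rw [show ((-1) ^ n * (2 * (n : ℤ⟦X⟧) + 1) : ℤ⟦X⟧) = C ((-1) ^ n * (2 * (n : ℤ) + 1)) by simp, coeff_C_mul,
    coeff_X_pow]
  simp

theorem coeff_eulerProd_cube (m : ℕ) : coeff m (eulerProd ^ 3) =
    ∑ n ∈ Finset.range (m + 1), if m = (n + 1).choose 2 then (-1) ^ n * (2 * (n : ℤ) + 1) else 0 := by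
  have h := X_pow_dvd_iff.1 (X_pow_dvd_eulerProd_cube_sub m) m (Nat.lt_succ_self m)
  rw [map_sub, sub_eq_zero, map_sum] at h
  rw [h]
  exact Finset.sum_congr rfl fun n _ => coeff_term_jacobi n m

theorem coeff_eulerProd_cube_triangle (n : ℕ) :
    coeff ((n + 1).choose 2) (eulerProd ^ 3) = (-1) ^ n * (2 * (n : ℤ) + 1) := by
  rw [coeff_eulerProd_cube, Finset.sum_eq_single n]
  · simp
  · intro k _ hk
    exact if_neg fun h => hk (choose_two_strictMono.injective h).symm
  · intro h
    exact absurd (Finset.mem_range.2 (Nat.lt_succ_of_le (choose_two_strictMono.id_le n))) h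

theorem coeff_eulerProd_cube_of_ne {m : ℕ} (h : ∀ n : ℕ, m ≠ (n + 1).choose 2) :
    coeff m (eulerProd ^ 3) = 0 := by
  rw [coeff_eulerProd_cube]
  exact Finset.sum_eq_zero fun n _ => if_neg (h n)

/-! ### Consequences of Jacobi's identity for the third and sixth powers. -/

theorem two_mul_choose_succ_two (n : ℕ) : 2 * (n + 1).choose 2 = n * (n + 1) := by
  rw [Nat.choose_two_right, Nat.mul_div_cancel' (Nat.even_mul_pred_self _).two_dvd,
    Nat.add_sub_cancel]
  ring

theorem expand_three_injective {R : Type*} [CommRing R] :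
    Function.Injective (expand 3 three_ne_zero : R⟦X⟧ → R⟦X⟧) := by
  intro g h e
  ext n
  rw [← coeff_expand_mul 3 three_ne_zero g, e, coeff_expand_mul]

/-- The 3-dissection of the cube of Euler's product. -/
theorem exists_eulerProd_cube_eq : ∃ A : ℤ⟦X⟧, eulerProd ^ 3 = expand 3 three_ne_zero A -
    3 * X * expand 3 three_ne_zero (expand 3 three_ne_zero eulerProd) ^ 3 := by
  refine ⟨PowerSeries.mk fun n => coeff (3 * n) (eulerProd ^ 3), ?_⟩
  ext m
  rw [← map_pow, ← map_pow, map_sub, mul_assoc, show (3 : ℤ⟦X⟧) = C 3 by simp, coeff_C_mul]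
  have hmod : m % 3 = 0 ∨ m % 3 = 1 ∨ m % 3 = 2 := by omega
  have hT := two_mul_choose_succ_two
  rcases hmod with h | h | h
  · obtain ⟨k, rfl⟩ := Nat.dvd_of_mod_eq_zero h
    rw [coeff_expand_mul, coeff_mk]
    have : coeff (3 * k) (X * expand 3 three_ne_zero (expand 3 three_ne_zero (eulerProd ^ 3))) = 0 := by
      rcases k with _ | k
      · simp
      · rw [show 3 * (k + 1) = 3 * k + 2 + 1 by ring, coeff_succ_X_mul]
        exact coeff_expand_of_not_dvd _ _ _ (by omega)
    rw [this]
    ring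
  · obtain ⟨k, rfl⟩ : ∃ k, m = 3 * k + 1 := ⟨m / 3, by omega⟩
    rw [coeff_expand_of_not_dvd _ _ _ (by omega), coeff_succ_X_mul, coeff_expand_mul]
    by_cases hk : ∃ n, 3 * k + 1 = (n + 1).choose 2
    · obtain ⟨n, hn⟩ := hk
      have h1 := hT n
      rw [← hn] at h1
      have hn3 : n % 3 = 1 := by
        have : (n * (n + 1)) % 3 = 2 := by omega
        rw [Nat.mul_mod, Nat.add_mod] at this
        have : n % 3 < 3 := Nat.mod_lt _ (by norm_num)
        interval_cases h : n % 3 <;> simp_all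
      -- For n = 3j + 1 the triangular number is 9 T_j + 1, the weight is 2n + 1 = 3(2j + 1), and
      -- (-1)^n = -(-1)^j: this is the term -3q E(q^9)^3.
      obtain ⟨j, rfl⟩ : ∃ j, n = 3 * j + 1 := ⟨n / 3, by omega⟩
      have hk : k = 3 * (j + 1).choose 2 := by
        have := hT j
        nlinarith
      rw [hn, coeff_eulerProd_cube_triangle, hk, coeff_expand_mul, coeff_eulerProd_cube_triangle,
        pow_succ, pow_mul]
      push_cast
      norm_num
      ring
    · rw [coeff_eulerProd_cube_of_ne fun n e => hk ⟨n, e⟩]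
      rw [coeff_expand]
      split_ifs with h3
      · obtain ⟨j, rfl⟩ := h3
        rw [Nat.mul_div_cancel_left _ (by norm_num), coeff_eulerProd_cube_of_ne]
        · simp
        · rintro n rfl
          refine hk ⟨3 * n + 1, ?_⟩
          have h1 := hT n
          have h2 := hT (3 * n + 1)
          nlinarith
      · simp
  · obtain ⟨k, rfl⟩ : ∃ k, m = 3 * k + 1 + 1 := ⟨m / 3, by omega⟩
    rw [coeff_expand_of_not_dvd _ _ _ (by omega), coeff_succ_X_mul,
      coeff_expand_of_not_dvd _ _ _ (by omega), coeff_eulerProd_cube_of_ne]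
    · simp
    · intro n hn
      have h1 := hT n
      rw [← hn] at h1
      have : (n * (n + 1)) % 3 = 1 := by omega
      rw [Nat.mul_mod, Nat.add_mod] at this
      have : n % 3 < 3 := Nat.mod_lt _ (by norm_num)
      interval_cases h : n % 3 <;> simp_all

/-- The coefficients of the sixth power of Euler's product are supported on the numbers `N` for
which `8 * N + 2` is a sum of two squares. -/
theorem coeff_eulerProd_pow_six {N : ℕ} (h : ¬ ∃ x y : ℕ, 8 * N + 2 = x ^ 2 + y ^ 2) :
    coeff N (eulerProd ^ 6) = 0 := by
  rw [show eulerProd ^ 6 = eulerProd ^ 3 * eulerProd ^ 3 by ring, coeff_mul]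
  refine Finset.sum_eq_zero fun p hp => ?_
  rw [Finset.HasAntidiagonal.mem_antidiagonal] at hp
  by_cases h1 : ∃ n, p.1 = (n + 1).choose 2
  · by_cases h2 : ∃ n, p.2 = (n + 1).choose 2
    · obtain ⟨a, ha⟩ := h1
      obtain ⟨b, hb⟩ := h2
      refine absurd ⟨2 * a + 1, 2 * b + 1, ?_⟩ h
      have h3 := two_mul_choose_succ_two a
      have h4 := two_mul_choose_succ_two b
      rw [← hp, ha, hb]
      nlinarith
    · rw [coeff_eulerProd_cube_of_ne fun n e => h2 ⟨n, e⟩, mul_zero]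
  · rw [coeff_eulerProd_cube_of_ne fun n e => h1 ⟨n, e⟩, zero_mul]

/-- Here 8N + 2 = p^(2k+1) (8n + 2p) with p ∤ 8n + 2p, so a prime p ≡ 3 mod 4 divides it to an odd
power and it is not a sum of two squares. -/
theorem coeff_eulerProd_pow_six_eq_zero {p n k : ℕ} (hp : p.Prime) (h4 : p ≡ 3 [MOD 4])
    (hn : ¬ p ∣ n) :
    coeff (p ^ (2 * k + 1) * n + (p ^ (2 * k + 2) - 1) / 4) (eulerProd ^ 6) = 0 := by
  have h4' : p % 4 = 3 := h4
  apply coeff_eulerProd_pow_six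
  rw [Nat.eq_sq_add_sq_iff]
  intro h
  have e : 8 * (p ^ (2 * k + 1) * n + (p ^ (2 * k + 2) - 1) / 4) + 2 =
      p ^ (2 * k + 1) * (8 * n + 2 * p) := by
    have h1 : p ^ (2 * k + 2) % 4 = 1 := by
      rw [show 2 * k + 2 = 2 * (k + 1) by ring, pow_mul, Nat.pow_mod, Nat.pow_mod p, h4']
      simp
    have h2 : p ^ (2 * k + 2) = p ^ (2 * k + 1) * p := pow_succ _ _
    have h3 : 4 * ((p ^ (2 * k + 2) - 1) / 4) + 1 = p ^ (2 * k + 2) := by omega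
    nlinarith
  rw [e] at h
  have hpd : ¬ p ∣ 8 * n + 2 * p := by
    rw [Nat.dvd_add_left (Dvd.intro_left _ rfl), hp.dvd_mul]
    rintro (h8 | h8)
    · have : p ∣ 2 := hp.dvd_of_dvd_pow (n := 3) (by simpa using h8)
      have := Nat.le_of_dvd (by norm_num) this
      omega
    · exact hn h8
  have hne : 8 * n + 2 * p ≠ 0 := by have := hp.pos; omega
  have : Fact p.Prime := ⟨hp⟩
  have hm : p ^ (2 * k + 1) ≠ 0 := pow_ne_zero _ hp.ne_zero
  have h5 := h p (Nat.mem_primeFactors.2 ⟨hp, dvd_mul_of_dvd_left (dvd_pow_self _ (by omega)) _,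
    mul_ne_zero hm hne⟩) h4'
  rw [padicValNat.mul hm hne, padicValNat.prime_pow, padicValNat.eq_zero_of_not_dvd hpd] at h5
  exact absurd h5 (by simp)

/-! ### The norm over the cube roots of unity. -/

noncomputable section Norm

/-- Euler's product with complex coefficients. -/
def eulerProdC : ℂ⟦X⟧ := PowerSeries.map (Int.castRingHom ℂ) eulerProd

theorem hasProd_eulerProdC : HasProd (fun n : ℕ => (1 - X ^ (n + 1) : ℂ⟦X⟧)) eulerProdC := by
  have h := hasProd_eulerProd.map (PowerSeries.map (Int.castRingHom ℂ)) (by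
    rw [continuous_iff_continuousAt]
    intro g
    rw [ContinuousAt, tendsto_iff_coeff_tendsto]
    intro d
    simp only [coeff_map]
    exact ((continuous_of_discreteTopology (f := Int.castRingHom ℂ)).comp
      (continuous_coeff ℤ d)).tendsto g)
  simpa [Function.comp_def, eulerProdC] using h

theorem continuous_rescale (a : ℂ) : Continuous (rescale a : ℂ⟦X⟧ →+* ℂ⟦X⟧) := by
  rw [continuous_iff_continuousAt]
  intro g
  rw [ContinuousAt, tendsto_iff_coeff_tendsto]
  intro d
  simp only [coeff_rescale]
  exact (continuous_const.mul (continuous_coeff ℂ d)).tendsto g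

theorem continuous_expand_three :
    Continuous (expand 3 three_ne_zero : ℂ⟦X⟧ → ℂ⟦X⟧) := by
  rw [continuous_iff_continuousAt]
  intro g
  rw [ContinuousAt, tendsto_iff_coeff_tendsto]
  intro d
  simp only [coeff_expand]
  split_ifs
  · exact (continuous_coeff ℂ _).tendsto g
  · exact tendsto_const_nhds

theorem hasProd_rescale_eulerProdC (a : ℂ) :
    HasProd (fun n : ℕ => (1 - C (a ^ (n + 1)) * X ^ (n + 1) : ℂ⟦X⟧)) (rescale a eulerProdC) := by
  have h := hasProd_eulerProdC.map (rescale a) (continuous_rescale a)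
  simpa [Function.comp_def, rescale_X, mul_pow] using h

theorem hasProd_expand_eulerProdC : HasProd (fun n : ℕ => (1 - X ^ (3 * (n + 1)) : ℂ⟦X⟧))
    (expand 3 three_ne_zero eulerProdC) := by
  have h := hasProd_eulerProdC.map (expand 3 three_ne_zero) continuous_expand_three
  simpa [Function.comp_def, pow_mul] using h

theorem hasProd_expand_expand_eulerProdC : HasProd (fun n : ℕ => (1 - X ^ (9 * (n + 1)) : ℂ⟦X⟧))
    (expand 3 three_ne_zero (expand 3 three_ne_zero eulerProdC)) := by
  have h := hasProd_expand_eulerProdC.map (expand 3 three_ne_zero) continuous_expand_three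
  refine (by simpa [Function.comp_def, ← pow_mul, ← mul_assoc] using h)

/-- Indexes a product over multiples of 3 by all integers, so that the two sides of
`prod_rescale_eulerProdC` can be compared factor by factor. -/
theorem hasProd_multiples {g : ℕ → ℂ⟦X⟧} {a : ℂ⟦X⟧} (h : HasProd (fun n => g (3 * (n + 1))) a) :
    HasProd (fun n => if 3 ∣ n + 1 then g (n + 1) else 1) a := by
  have hi : Function.Injective fun n : ℕ => 3 * n + 2 := fun a b h => by simpa using h
  rw [← hi.hasProd_iff]
  · convert h using 2 with n
    rw [Function.comp_apply, if_pos (by omega)]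
    rfl
  · intro n hn
    rw [if_neg]
    intro h3
    exact hn ⟨n / 3, by simp only; omega⟩

/-- For 3 ∤ n the three conjugates of 1 - q^n multiply to 1 - q^(3n). For 3 ∣ n they give (1 -
q^n)^3, and E(q^9) supplies the missing 1 - q^(3n). -/
theorem prod_rescale_eulerProdC {ω : ℂ} (hω : ω ^ 2 + ω + 1 = 0) :
    eulerProdC * rescale ω eulerProdC * rescale (ω ^ 2) eulerProdC *
      expand 3 three_ne_zero (expand 3 three_ne_zero eulerProdC) =
      expand 3 three_ne_zero eulerProdC ^ 4 := by
  have hω3 : ω ^ 3 = 1 := by linear_combination (ω - 1) * hω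
  have h1 := ((hasProd_eulerProdC.mul (hasProd_rescale_eulerProdC ω)).mul
    (hasProd_rescale_eulerProdC (ω ^ 2))).mul
    (hasProd_multiples (g := fun n => 1 - X ^ (3 * n)) (by
      simpa [← mul_assoc] using hasProd_expand_expand_eulerProdC))
  have h3 := hasProd_multiples (g := fun n => 1 - X ^ n) hasProd_expand_eulerProdC
  have h2 := hasProd_expand_eulerProdC.mul ((h3.mul h3).mul h3)
  rw [show expand 3 three_ne_zero eulerProdC ^ 4 = expand 3 three_ne_zero eulerProdC *
    (expand 3 three_ne_zero eulerProdC * expand 3 three_ne_zero eulerProdC *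
    expand 3 three_ne_zero eulerProdC) by ring]
  refine h1.unique ?_
  convert h2 using 2 with n
  have hC : (C ω : ℂ⟦X⟧) ^ 2 + C ω + 1 = 0 := by
    simpa using congrArg (C : ℂ → ℂ⟦X⟧) hω
  have hC3 : (C ω : ℂ⟦X⟧) ^ 3 = 1 := by linear_combination (C ω - 1) * hC
  simp only [map_pow]
  split_ifs with h
  · obtain ⟨m, hm⟩ := h
    rw [hm, ← pow_mul, show 2 * (3 * m) = 3 * (2 * m) by ring, pow_mul (C ω), pow_mul (C ω), hC3]
    simp
    ring
  · have key : (C ω : ℂ⟦X⟧) ^ (n + 1) + (C ω ^ 2) ^ (n + 1) + 1 = 0 := by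
      have : (n + 1) % 3 = 1 ∨ (n + 1) % 3 = 2 := by omega
      rw [← pow_mul, ← Nat.div_add_mod (n + 1) 3]
      rcases this with h | h <;> rw [h]
      · rw [show 2 * (3 * ((n + 1) / 3) + 1) = 3 * (2 * ((n + 1) / 3)) + 2 by ring, pow_add,
          pow_add, pow_mul, pow_mul (C ω) 3, hC3]
        linear_combination hC
      · rw [show 2 * (3 * ((n + 1) / 3) + 2) = 3 * (2 * ((n + 1) / 3) + 1) + 1 by ring, pow_add,
          pow_add, pow_mul, pow_mul (C ω) 3, hC3]
        linear_combination hC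
    have key2 : (C ω : ℂ⟦X⟧) ^ (n + 1) * (C ω ^ 2) ^ (n + 1) = 1 := by
      rw [← mul_pow, ← pow_succ', hC3, one_pow]
    rw [pow_mul' X 3]
    linear_combination (-X ^ (n + 1) + X ^ (n + 1) * X ^ (n + 1)) * key +
      (X ^ (n + 1) * X ^ (n + 1) - X ^ (n + 1) * X ^ (n + 1) * X ^ (n + 1)) * key2

theorem rescale_expand_three {ω : ℂ} (hω3 : ω ^ 3 = 1) (g : ℂ⟦X⟧) :
    rescale ω (expand 3 three_ne_zero g) = expand 3 three_ne_zero g := by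
  ext n
  rw [coeff_rescale, coeff_expand]
  split_ifs with h
  · obtain ⟨m, rfl⟩ := h
    rw [pow_mul, hω3, one_pow, one_mul]
  · simp

/-- With Y = 3q E(q^9)^3, the conjugates of A(q^3) - Y multiply to A(q^3)^3 - Y^3, while those of
E^3 are evaluated by `prod_rescale_eulerProdC`. -/
theorem norm_eulerProd_cube {A : ℤ⟦X⟧} (hA : eulerProd ^ 3 = expand 3 three_ne_zero A -
      3 * X * expand 3 three_ne_zero (expand 3 three_ne_zero eulerProd) ^ 3) :
    (A ^ 3 - 27 * X * expand 3 three_ne_zero eulerProd ^ 9) *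
      expand 3 three_ne_zero eulerProd ^ 3 = eulerProd ^ 12 := by
  obtain ⟨ω, hω⟩ : ∃ ω : ℂ, ω ^ 2 + ω + 1 = 0 := by
    obtain ⟨ω, h⟩ := IsAlgClosed.exists_root
      (Polynomial.X ^ 2 + Polynomial.X + 1 : Polynomial ℂ) (by
        have : (Polynomial.X ^ 2 + Polynomial.X + 1 : Polynomial ℂ).degree = 2 := by compute_degree!
        rw [this]
        norm_num)
    exact ⟨ω, by simpa using h⟩
  have hω3 : ω ^ 3 = 1 := by linear_combination (ω - 1) * hω
  have hω6 : (ω ^ 2) ^ 3 = 1 := by rw [← pow_mul, mul_comm, pow_mul, hω3, one_pow]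
  have hinj : Function.Injective (PowerSeries.map (Int.castRingHom ℂ)) :=
    PowerSeries.map_injective _ Int.cast_injective
  apply hinj
  -- The norm is a series in q^3, so the identity is checked after q ↦ q^3.
  apply expand_three_injective
  set B := PowerSeries.map (Int.castRingHom ℂ) A with hB
  have h0 : eulerProdC ^ 3 = expand 3 three_ne_zero B -
      3 * X * expand 3 three_ne_zero (expand 3 three_ne_zero eulerProdC) ^ 3 := by
    have h := congrArg (PowerSeries.map (Int.castRingHom ℂ)) hA
    simp only [map_sub, map_mul, map_pow, map_expand, map_X, map_ofNat] at h
    exact h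
  have h1 := congrArg (rescale ω) h0
  have h2 := congrArg (rescale (ω ^ 2)) h0
  simp only [map_sub, map_mul, map_pow, rescale_expand_three hω3, rescale_expand_three hω6,
    rescale_X, map_ofNat] at h1 h2
  have hp := prod_rescale_eulerProdC hω
  simp only [map_sub, map_mul, map_pow, map_expand, map_X, map_ofNat, expand_X, ← hB]
  change (expand 3 three_ne_zero B ^ 3 -
    27 * X ^ 3 * expand 3 three_ne_zero (expand 3 three_ne_zero eulerProdC) ^ 9) *
    expand 3 three_ne_zero (expand 3 three_ne_zero eulerProdC) ^ 3 =
    expand 3 three_ne_zero eulerProdC ^ 12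
  set F9 := expand 3 three_ne_zero (expand 3 three_ne_zero eulerProdC)
  set F3 := expand 3 three_ne_zero eulerProdC
  set B3 := expand 3 three_ne_zero B
  have hC : (C ω : ℂ⟦X⟧) ^ 2 + C ω + 1 = 0 := by
    simpa using congrArg (C : ℂ → ℂ⟦X⟧) hω
  have hC3 : (C ω : ℂ⟦X⟧) ^ 3 = 1 := by linear_combination (C ω - 1) * hC
  calc (B3 ^ 3 - 27 * X ^ 3 * F9 ^ 9) * F9 ^ 3
      = (eulerProdC ^ 3 * rescale ω eulerProdC ^ 3 * rescale (ω ^ 2) eulerProdC ^ 3) * F9 ^ 3 := by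
        rw [h0, h1, h2]
        congr 1
        have e : ∀ Y : ℂ⟦X⟧, B3 ^ 3 - Y ^ 3 = (B3 - Y) * (B3 - C ω * Y) * (B3 - C ω ^ 2 * Y) :=
          fun Y => by
            linear_combination (B3 ^ 2 * Y - B3 * Y ^ 2 * C ω) * hC + Y ^ 3 * hC3
        have := e (3 * X * F9 ^ 3)
        linear_combination this
    _ = (eulerProdC * rescale ω eulerProdC * rescale (ω ^ 2) eulerProdC * F9) ^ 3 := by ring
    _ = F3 ^ 12 := by rw [hp]; ring

end Norm

/-! ### The operator U and the relations between s and x. -/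

noncomputable section Dissection

/-- The substitution `q ↦ q ^ 3`. -/
def cubeSubst : ℤ⟦X⟧ →+* ℤ⟦X⟧ := (expand 3 three_ne_zero : ℤ⟦X⟧ →ₐ[ℤ] ℤ⟦X⟧)

theorem cubeSubst_apply (g : ℤ⟦X⟧) : cubeSubst g = expand 3 three_ne_zero g := rfl

theorem cubeSubst_X : cubeSubst X = X ^ 3 := expand_X 3 three_ne_zero

theorem coeff_cubeSubst_of_not_dvd (g : ℤ⟦X⟧) {n : ℕ} (h : ¬ 3 ∣ n) : coeff n (cubeSubst g) = 0 :=
  coeff_expand_of_not_dvd 3 three_ne_zero g h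

theorem coeff_three_mul_cubeSubst (g : ℤ⟦X⟧) (n : ℕ) :
    coeff (3 * n) (cubeSubst g) = coeff n g := coeff_expand_mul 3 three_ne_zero g n

/-- Extraction of the coefficients whose index is a multiple of `3`. -/
def extractThree : ℤ⟦X⟧ →+ ℤ⟦X⟧ where
  toFun g := PowerSeries.mk fun n => coeff (3 * n) g
  map_zero' := by ext n; simp
  map_add' g h := by ext n; simp

theorem coeff_extractThree (g : ℤ⟦X⟧) (n : ℕ) : coeff n (extractThree g) = coeff (3 * n) g :=
  coeff_mk n fun n => coeff (3 * n) g

theorem exists_dissection (g : ℤ⟦X⟧) :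
    ∃ a b c, g = cubeSubst a + X * cubeSubst b + X ^ 2 * cubeSubst c := by
  refine ⟨PowerSeries.mk fun n => coeff (3 * n) g, PowerSeries.mk fun n => coeff (3 * n + 1) g,
    PowerSeries.mk fun n => coeff (3 * n + 2) g, ?_⟩
  ext n
  rw [pow_two, mul_assoc, map_add, map_add]
  have hn := Nat.div_add_mod n 3
  have h : n % 3 = 0 ∨ n % 3 = 1 ∨ n % 3 = 2 := by omega
  rcases h with h | h | h
  · obtain ⟨k, rfl⟩ := Nat.dvd_of_mod_eq_zero h
    rw [coeff_three_mul_cubeSubst, coeff_mk]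
    rcases k with _ | k
    · simp
    · rw [show 3 * (k + 1) = 3 * k + 1 + 1 + 1 by ring, coeff_succ_X_mul, coeff_succ_X_mul,
        coeff_succ_X_mul, coeff_cubeSubst_of_not_dvd _ (by omega),
        coeff_cubeSubst_of_not_dvd _ (by omega)]
      ring
  · obtain ⟨k, rfl⟩ : ∃ k, n = 3 * k + 1 := ⟨n / 3, by omega⟩
    rw [coeff_cubeSubst_of_not_dvd _ (by omega), coeff_succ_X_mul, coeff_succ_X_mul,
      coeff_three_mul_cubeSubst, coeff_mk]
    rcases k with _ | k
    · simp
    · rw [show 3 * (k + 1) = 3 * k + 2 + 1 by ring, coeff_succ_X_mul,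
        coeff_cubeSubst_of_not_dvd _ (by omega)]
      ring
  · obtain ⟨k, rfl⟩ : ∃ k, n = 3 * k + 1 + 1 := ⟨n / 3, by omega⟩
    rw [coeff_cubeSubst_of_not_dvd _ (by omega), coeff_succ_X_mul, coeff_succ_X_mul,
      coeff_succ_X_mul, coeff_cubeSubst_of_not_dvd _ (by omega), coeff_three_mul_cubeSubst,
      coeff_mk]
    ring

theorem extractThree_dissection (a b c : ℤ⟦X⟧) :
    extractThree (cubeSubst a + X * cubeSubst b + X ^ 2 * cubeSubst c) = a := by
  ext n
  rw [coeff_extractThree, pow_two, mul_assoc, map_add, map_add, coeff_three_mul_cubeSubst]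
  rcases n with _ | n
  · simp
  · rw [show 3 * (n + 1) = 3 * n + 1 + 1 + 1 by ring, coeff_succ_X_mul, coeff_succ_X_mul,
      coeff_succ_X_mul, coeff_cubeSubst_of_not_dvd _ (by omega),
      coeff_cubeSubst_of_not_dvd _ (by omega)]
    ring

theorem extractThree_cubeSubst_mul (g h : ℤ⟦X⟧) :
    extractThree (cubeSubst g * h) = g * extractThree h := by
  obtain ⟨a, b, c, rfl⟩ := exists_dissection h
  rw [extractThree_dissection, show cubeSubst g * (cubeSubst a + X * cubeSubst b +
    X ^ 2 * cubeSubst c) = cubeSubst (g * a) + X * cubeSubst (g * b) + X ^ 2 * cubeSubst (g * c) by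
      simp only [map_mul]; ring, extractThree_dissection]

/-- Partition generating function in `q ^ 3`. -/
abbrev partitionSeriesThree : ℤ⟦X⟧ := cubeSubst partitionSeries

/-- Euler's product in `q ^ 3`. -/
abbrev eulerProdThree : ℤ⟦X⟧ := cubeSubst eulerProd

/-- The Hauptmodul `q ∏ (1 - q ^ (9 n)) ^ 3 / (1 - q ^ n) ^ 3` of level 9. -/
def hauptNine : ℤ⟦X⟧ := X * cubeSubst eulerProdThree ^ 3 * partitionSeries ^ 3

/-- The Hauptmodul `q ∏ (1 - q ^ (3 n)) ^ 12 / (1 - q ^ n) ^ 12` of level 3. -/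
def hauptThree : ℤ⟦X⟧ := X * eulerProdThree ^ 12 * partitionSeries ^ 12

theorem cubeSubst_partition_mul : partitionSeriesThree * eulerProdThree = 1 := by
  rw [← map_mul, partitionSeries_mul_eulerProd, map_one]

/-- The 3-dissection of the third power of the partition generating function, together with
the relations between its components. -/
theorem exists_partitionSeries_cube_eq : ∃ A D : ℤ⟦X⟧,
    D * eulerProdThree ^ 9 * X = hauptThree ∧
    A ^ 3 * D = 1 + 27 * X * eulerProdThree ^ 9 * D ∧
    partitionSeries ^ 3 = (cubeSubst A ^ 2 + 3 * X * cubeSubst A * cubeSubst eulerProdThree ^ 3 +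
      9 * X ^ 2 * cubeSubst eulerProdThree ^ 6) * cubeSubst D ∧
    eulerProd ^ 3 = cubeSubst A - 3 * X * cubeSubst eulerProdThree ^ 3 := by
  obtain ⟨A, hA⟩ := exists_eulerProd_cube_eq
  have hN := norm_eulerProd_cube hA
  simp only [← cubeSubst_apply] at hA hN
  have hP := partitionSeries_mul_eulerProd
  have hP12 : partitionSeries ^ 12 * eulerProd ^ 12 = 1 := by rw [← mul_pow, hP, one_pow]
  have hP3 : partitionSeries ^ 3 * eulerProd ^ 3 = 1 := by rw [← mul_pow, hP, one_pow]
  have hD : (A ^ 3 - 27 * X * eulerProdThree ^ 9) *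
      (partitionSeries ^ 12 * eulerProdThree ^ 3) = 1 := by
    linear_combination partitionSeries ^ 12 * hN + hP12
  -- By the norm identity D is the inverse of A^3 - 27q E(q^3)^9; the formula for P^3 = 1/(A(q^3) -
  -- Y) comes from multiplying through by A(q^3)^2 + A(q^3) Y + Y^2, where Y = 3q E(q^9)^3.
  refine ⟨A, partitionSeries ^ 12 * eulerProdThree ^ 3, ?_, ?_, ?_, hA⟩
  · rw [hauptThree]
    ring
  · linear_combination hD
  · have hD3 := congrArg cubeSubst hD
    simp only [map_mul, map_sub, map_pow, map_one, cubeSubst_X, map_ofNat] at hD3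
    simp only [map_mul, map_pow]
    rw [hA] at hP3
    linear_combination (-partitionSeries ^ 3) * hD3 + (cubeSubst A ^ 2 +
      3 * X * cubeSubst A * cubeSubst eulerProdThree ^ 3 +
      9 * X ^ 2 * cubeSubst eulerProdThree ^ 6) *
      (cubeSubst partitionSeries ^ 12 * cubeSubst eulerProdThree ^ 3) * hP3

theorem extractThree_one : extractThree 1 = 1 := by
  simpa using extractThree_dissection 1 0 0

theorem extractThree_hauptNine : extractThree hauptNine = 9 * hauptThree := by
  obtain ⟨A, D, h1, -, h3, -⟩ := exists_partitionSeries_cube_eq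
  rw [hauptNine, h3, show X * cubeSubst eulerProdThree ^ 3 * ((cubeSubst A ^ 2 +
    3 * X * cubeSubst A * cubeSubst eulerProdThree ^ 3 +
      9 * X ^ 2 * cubeSubst eulerProdThree ^ 6) * cubeSubst D) =
    cubeSubst (9 * (D * eulerProdThree ^ 9 * X)) + X * cubeSubst (eulerProdThree ^ 3 * A ^ 2 * D) +
      X ^ 2 * cubeSubst (3 * A * eulerProdThree ^ 6 * D) by
    simp only [map_mul, map_pow, cubeSubst_X, map_ofNat]; ring, extractThree_dissection, h1]

/-- In the part of s^2 with exponents divisible by 3, A occurs only through A^3 D, which the norm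
relation expresses by x. -/
theorem extractThree_hauptNine_sq :
    extractThree (hauptNine ^ 2) = 6 * hauptThree + 243 * hauptThree ^ 2 := by
  obtain ⟨A, D, h1, h2, h3, -⟩ := exists_partitionSeries_cube_eq
  rw [hauptNine, h3, show (X * cubeSubst eulerProdThree ^ 3 * ((cubeSubst A ^ 2 +
    3 * X * cubeSubst A * cubeSubst eulerProdThree ^ 3 +
      9 * X ^ 2 * cubeSubst eulerProdThree ^ 6) * cubeSubst D)) ^ 2 =
    cubeSubst (6 * (D * eulerProdThree ^ 9 * X) * (A ^ 3 * D) +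
      81 * (D * eulerProdThree ^ 9 * X) ^ 2) +
    X * cubeSubst (27 * X * A ^ 2 * eulerProdThree ^ 12 * D ^ 2) +
      X ^ 2 * cubeSubst (A ^ 4 * eulerProdThree ^ 6 * D ^ 2 +
        54 * X * A * eulerProdThree ^ 15 * D ^ 2) by
    simp only [map_mul, map_pow, map_add, cubeSubst_X, map_ofNat]; ring,
    extractThree_dissection, h2, show 27 * X * eulerProdThree ^ 9 * D =
      27 * (D * eulerProdThree ^ 9 * X) by ring, h1]
  ring

/-- Since 1 + 3s = P^3 A(q^3), the quantity (1 + 3s)^3 - 27s^3 = 1 + 9s + 27s^2 is a norm times P^9,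
hence an eta quotient. -/
theorem hauptNine_cube : hauptNine ^ 3 =
    cubeSubst hauptThree * (1 + 9 * hauptNine + 27 * hauptNine ^ 2) := by
  obtain ⟨A, hA⟩ := exists_eulerProd_cube_eq
  have hN := congrArg cubeSubst (norm_eulerProd_cube hA)
  simp only [← cubeSubst_apply] at hA hN
  simp only [map_mul, map_sub, map_pow, cubeSubst_X, map_ofNat] at hN
  have hP3 : partitionSeries ^ 3 * eulerProd ^ 3 = 1 := by
    rw [← mul_pow, partitionSeries_mul_eulerProd, one_pow]
  have hQ : cubeSubst partitionSeriesThree * cubeSubst eulerProdThree = 1 := by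
    rw [← map_mul, cubeSubst_partition_mul, map_one]
  have hR := cubeSubst_partition_mul
  have h1 : 1 + 3 * hauptNine = partitionSeries ^ 3 * cubeSubst A := by
    rw [hauptNine]
    linear_combination (-1 : ℤ⟦X⟧) * hP3 + partitionSeries ^ 3 * hA
  have h2 : 1 + 9 * hauptNine + 27 * hauptNine ^ 2 =
      eulerProdThree ^ 12 * partitionSeries ^ 9 * cubeSubst partitionSeriesThree ^ 3 := by
    have hQ3 : cubeSubst partitionSeriesThree ^ 3 * cubeSubst eulerProdThree ^ 3 = 1 := by
      rw [← mul_pow, hQ, one_pow]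
    have e : 1 + 9 * hauptNine + 27 * hauptNine ^ 2 =
        (1 + 3 * hauptNine) ^ 3 - 27 * hauptNine ^ 3 := by ring
    rw [e, h1, hauptNine]
    linear_combination (-partitionSeries ^ 9 * (cubeSubst A ^ 3 -
      27 * X ^ 3 * cubeSubst eulerProdThree ^ 9)) * hQ3 +
      partitionSeries ^ 9 * cubeSubst partitionSeriesThree ^ 3 * hN
  have hR12 : partitionSeriesThree ^ 12 * eulerProdThree ^ 12 = 1 := by
    rw [← mul_pow, hR, one_pow]
  have hQ3 : cubeSubst partitionSeriesThree ^ 3 * cubeSubst eulerProdThree ^ 3 = 1 := by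
    rw [← mul_pow, hQ, one_pow]
  rw [h2, hauptThree, hauptNine]
  simp only [map_mul, map_pow, cubeSubst_X]
  linear_combination (-X ^ 3 * cubeSubst eulerProdThree ^ 9 * partitionSeries ^ 9) *
    (cubeSubst eulerProdThree ^ 3 * cubeSubst partitionSeriesThree ^ 3 * hR12 + hQ3)

/-- Directly from the products, x(q^3) x = s^4; divide s times the cubic equation by x(q^3). -/
theorem hauptThree_eq : hauptThree = hauptNine + 9 * hauptNine ^ 2 + 27 * hauptNine ^ 3 := by
  have h := hauptNine_cube
  have hne : cubeSubst hauptThree ≠ 0 := by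
    intro h0
    have hinj : hauptThree = 0 := expand_three_injective (by
      rw [← cubeSubst_apply, ← cubeSubst_apply, h0, map_zero])
    have h1 : hauptThree * (partitionSeriesThree ^ 12 * eulerProd ^ 12) = X := by
      rw [hauptThree]
      have hP : partitionSeries ^ 12 * eulerProd ^ 12 = 1 := by
        rw [← mul_pow, partitionSeries_mul_eulerProd, one_pow]
      have hR : partitionSeriesThree ^ 12 * eulerProdThree ^ 12 = 1 := by
        rw [← mul_pow, cubeSubst_partition_mul, one_pow]
      linear_combination X * (partitionSeries ^ 12 * eulerProd ^ 12) * hR + X * hP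
    rw [hinj, zero_mul] at h1
    exact X_ne_zero h1.symm
  apply mul_left_cancel₀ hne
  have h4 : cubeSubst hauptThree * hauptThree = hauptNine ^ 4 := by
    rw [hauptThree, hauptNine]
    simp only [map_mul, map_pow, cubeSubst_X]
    have hR : partitionSeriesThree ^ 12 * eulerProdThree ^ 12 = 1 := by
      rw [← mul_pow, cubeSubst_partition_mul, one_pow]
    linear_combination (X ^ 4 * cubeSubst eulerProdThree ^ 12 * partitionSeries ^ 12) * hR
  rw [h4]
  linear_combination hauptNine * h

end Dissection

/-! ### 3-adic lattices in powers of x. -/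

noncomputable section Lattice

/-- The lattice spanned by the `3 ^ e k * x ^ (k + 1)`, where `x` is the Hauptmodul of level 3. -/
def hauptLattice (e : ℕ → ℕ) : AddSubgroup ℤ⟦X⟧ :=
  AddSubgroup.closure (Set.range fun k => 3 ^ e k * hauptThree ^ (k + 1))

theorem gen_mem_hauptLattice (e : ℕ → ℕ) (k : ℕ) :
    3 ^ e k * hauptThree ^ (k + 1) ∈ hauptLattice e :=
  AddSubgroup.subset_closure ⟨k, rfl⟩

theorem pow_mul_mem_hauptLattice {e : ℕ → ℕ} {k m : ℕ} (h : e k ≤ m) :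
    3 ^ m * hauptThree ^ (k + 1) ∈ hauptLattice e := by
  obtain ⟨d, rfl⟩ := Nat.exists_eq_add_of_le h
  rw [show 3 ^ (e k + d) * hauptThree ^ (k + 1) =
    (3 ^ d : ℕ) • (3 ^ e k * hauptThree ^ (k + 1)) by rw [nsmul_eq_mul]; push_cast; ring]
  exact nsmul_mem (gen_mem_hauptLattice e k) _

/-- An additive map sending generators into a subgroup sends the lattice into it. -/
theorem map_mem_of_mem_hauptLattice {e : ℕ → ℕ} {G : AddSubgroup ℤ⟦X⟧} (φ : ℤ⟦X⟧ →+ ℤ⟦X⟧)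
    (h : ∀ k, φ (3 ^ e k * hauptThree ^ (k + 1)) ∈ G) {z : ℤ⟦X⟧} (hz : z ∈ hauptLattice e) :
    φ z ∈ G := by
  have : hauptLattice e ≤ G.comap φ := by
    rw [hauptLattice, AddSubgroup.closure_le]
    rintro _ ⟨k, rfl⟩
    exact h k
  exact this hz

theorem three_pow_mul_mem_hauptLattice {e e' : ℕ → ℕ} {m : ℕ} (h : ∀ k, e' k ≤ m + e k) {z : ℤ⟦X⟧}
    (hz : z ∈ hauptLattice e) : 3 ^ m * z ∈ hauptLattice e' := by
  refine map_mem_of_mem_hauptLattice (AddMonoidHom.mulLeft (3 ^ m)) (fun k => ?_) hz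
  rw [AddMonoidHom.coe_mulLeft, ← mul_assoc, ← pow_add]
  exact pow_mul_mem_hauptLattice (h k)

theorem three_pow_mul_haupt_mul_mem {e e' : ℕ → ℕ} {m : ℕ} (h : ∀ k, e' (k + 1) ≤ m + e k)
    {z : ℤ⟦X⟧} (hz : z ∈ hauptLattice e) : 3 ^ m * (hauptThree * z) ∈ hauptLattice e' := by
  rw [← mul_assoc]
  refine map_mem_of_mem_hauptLattice (AddMonoidHom.mulLeft (3 ^ m * hauptThree)) (fun k => ?_) hz
  rw [AddMonoidHom.coe_mulLeft, show 3 ^ m * hauptThree * (3 ^ e k * hauptThree ^ (k + 1)) =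
    3 ^ (m + e k) * hauptThree ^ (k + 1 + 1) by ring]
  exact pow_mul_mem_hauptLattice (h k)

/-- The lattice containing the images of `s ^ c` under the extraction operator. -/
def powLattice (c : ℕ) : AddSubgroup ℤ⟦X⟧ := hauptLattice fun k => (9 * k + 8 - 3 * c) / 2

theorem extractThree_hauptNine_pow_add_three (j : ℕ) : extractThree (hauptNine ^ (j + 3)) =
    hauptThree * extractThree (hauptNine ^ j) +
      3 ^ 2 * (hauptThree * extractThree (hauptNine ^ (j + 1))) +
      3 ^ 3 * (hauptThree * extractThree (hauptNine ^ (j + 2))) := by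
  have h : hauptNine ^ (j + 3) = cubeSubst hauptThree * hauptNine ^ j +
      cubeSubst (9 * hauptThree) * hauptNine ^ (j + 1) +
      cubeSubst (27 * hauptThree) * hauptNine ^ (j + 2) := by
    simp only [map_mul, map_ofNat]
    linear_combination hauptNine ^ j * hauptNine_cube
  rw [h, map_add, map_add, extractThree_cubeSubst_mul, extractThree_cubeSubst_mul,
    extractThree_cubeSubst_mul]
  ring

/-- The exponent (9k + 8 - 3c)/2 is unchanged by (k, c) ↦ (k + 1, c + 3), the effect of a factor x
in the recursion; raising c by 1 or 2 costs at most 2 or 3, paid by the coefficients 9 and 27.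
Subtraction in ℕ replaces negative exponents by 0. -/
theorem extractThree_hauptNine_pow_mem (j : ℕ) :
    extractThree (hauptNine ^ (j + 1)) ∈ powLattice (j + 1) := by
  induction j using Nat.strong_induction_on with
  | _ j ih =>
    match j with
    | 0 =>
      rw [zero_add, pow_one, extractThree_hauptNine,
        show 9 * hauptThree = 3 ^ 2 * hauptThree ^ (0 + 1) by ring]
      exact pow_mul_mem_hauptLattice (by norm_num)
    | 1 =>
      rw [extractThree_hauptNine_sq, show 6 * hauptThree + 243 * hauptThree ^ 2 =
        2 • (3 ^ 1 * hauptThree ^ (0 + 1)) + 3 ^ 5 * hauptThree ^ (1 + 1) by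
          rw [nsmul_eq_mul]; push_cast; ring]
      exact add_mem (nsmul_mem (pow_mul_mem_hauptLattice (by norm_num)) _)
        (pow_mul_mem_hauptLattice (by norm_num))
    | 2 =>
      -- Treated apart because the recursion involves U(1) = 1, a constant term that the induction
      -- hypothesis does not cover.
      rw [extractThree_hauptNine_pow_add_three 0, pow_zero, extractThree_one, zero_add, pow_one,
        zero_add, extractThree_hauptNine, extractThree_hauptNine_sq,
        show hauptThree * 1 + 3 ^ 2 * (hauptThree * (9 * hauptThree)) +
          3 ^ 3 * (hauptThree * (6 * hauptThree + 243 * hauptThree ^ 2)) =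
          3 ^ 0 * hauptThree ^ (0 + 1) + 3 ^ 5 * hauptThree ^ (1 + 1) +
          3 ^ 8 * hauptThree ^ (2 + 1) by ring]
      exact add_mem (add_mem (pow_mul_mem_hauptLattice (by norm_num))
        (pow_mul_mem_hauptLattice (by norm_num))) (pow_mul_mem_hauptLattice (by norm_num))
    | j + 3 =>
      rw [show j + 3 + 1 = (j + 1) + 3 by ring, extractThree_hauptNine_pow_add_three]
      refine add_mem (add_mem ?_ ?_) ?_
      · have := three_pow_mul_haupt_mul_mem (m := 0)
          (e' := fun k => (9 * k + 8 - 3 * (j + 1 + 3)) / 2) (fun k => by omega)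
          (ih j (by omega))
        rwa [pow_zero, one_mul] at this
      · exact three_pow_mul_haupt_mul_mem (fun k => by omega) (ih (j + 1) (by omega))
      · exact three_pow_mul_haupt_mul_mem (fun k => by omega) (ih (j + 2) (by omega))

/-- Replacing one x by s + 9s^2 + 27s^3 at a time reduces to powers of s; the factors 9 and 27 again
outweigh the rise in degree. -/
theorem extractThree_hauptThree_pow_mul_mem (i r : ℕ) (h : 0 < i + r) :
    extractThree (hauptThree ^ i * hauptNine ^ r) ∈ powLattice (i + r) := by
  induction i generalizing r with
  | zero =>
    obtain ⟨r, rfl⟩ := Nat.exists_eq_succ_of_ne_zero (by omega : r ≠ 0)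
    rw [pow_zero, one_mul, zero_add]
    exact extractThree_hauptNine_pow_mem r
  | succ i ih =>
    have e : hauptThree ^ (i + 1) * hauptNine ^ r = hauptThree ^ i * hauptNine ^ (r + 1) +
        cubeSubst (3 ^ 2) * (hauptThree ^ i * hauptNine ^ (r + 2)) +
        cubeSubst (3 ^ 3) * (hauptThree ^ i * hauptNine ^ (r + 3)) := by
      simp only [map_pow, map_ofNat]
      rw [pow_succ, hauptThree_eq]
      ring
    rw [e, map_add, map_add, extractThree_cubeSubst_mul, extractThree_cubeSubst_mul]
    refine add_mem (add_mem ?_ ?_) ?_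
    · have := ih (r + 1) (by omega)
      rwa [show i + (r + 1) = i + 1 + r by ring] at this
    · exact three_pow_mul_mem_hauptLattice (fun k => by omega) (ih (r + 2) (by omega))
    · exact three_pow_mul_mem_hauptLattice (fun k => by omega) (ih (r + 3) (by omega))

/-- The lattice spanned by the `3 ^ (v + 2 * k) * x ^ (k + 1)`. -/
def slopeLattice (v : ℕ) : AddSubgroup ℤ⟦X⟧ := hauptLattice fun k => v + 2 * k

/-- The gain 2 - r is attained on the coefficient of x in U(x s^r), where the exponent from
`powLattice` is 2, 1, 0 for r = 0, 1, 2 (the last by truncation). -/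
theorem extractThree_mul_hauptNine_pow_mem {v r : ℕ} (hr : r ≤ 2) {y : ℤ⟦X⟧}
    (hy : y ∈ slopeLattice v) : extractThree (y * hauptNine ^ r) ∈ slopeLattice (v + 2 - r) := by
  refine map_mem_of_mem_hauptLattice (extractThree.comp (AddMonoidHom.mulRight (hauptNine ^ r)))
    (fun k => ?_) hy
  change extractThree (3 ^ (v + 2 * k) * hauptThree ^ (k + 1) * hauptNine ^ r) ∈ _
  rw [mul_assoc, show (3 : ℤ⟦X⟧) ^ (v + 2 * k) = cubeSubst (3 ^ (v + 2 * k)) by simp only [map_pow, map_ofNat],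
    extractThree_cubeSubst_mul]
  exact three_pow_mul_mem_hauptLattice (fun j => by omega)
    (extractThree_hauptThree_pow_mul_mem (k + 1) r (by omega))

/-- Precision 81 suffices: the sharpest congruence below needs only 27 beyond 3^v. -/
theorem exists_eq_of_mem_slopeLattice {v : ℕ} {y : ℤ⟦X⟧} (hy : y ∈ slopeLattice v) :
    ∃ (c d : ℤ) (w : ℤ⟦X⟧),
      y = 3 ^ v * (c * hauptThree + 9 * d * hauptThree ^ 2 + 81 * w) := by
  induction hy using AddSubgroup.closure_induction with
  | mem z hz =>
    obtain ⟨k, rfl⟩ := hz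
    match k with
    | 0 => exact ⟨1, 0, 0, by push_cast; ring⟩
    | 1 => exact ⟨0, 1, 0, by push_cast; ring⟩
    | k + 2 => exact ⟨0, 0, 9 ^ k * hauptThree ^ (k + 3), by
        push_cast
        rw [pow_add, pow_mul, show (3 : ℤ⟦X⟧) ^ 2 = 9 by norm_num]
        ring⟩
  | zero => exact ⟨0, 0, 0, by simp⟩
  | add z z' _ _ h h' =>
    obtain ⟨c, d, w, rfl⟩ := h
    obtain ⟨c', d', w', rfl⟩ := h'
    exact ⟨c + c', d + d', w + w', by push_cast; ring⟩
  | neg z _ h =>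
    obtain ⟨c, d, w, rfl⟩ := h
    exact ⟨-c, -d, -w, by push_cast; ring⟩

end Lattice

/-! ### Sections along arithmetic progressions. -/

noncomputable section Progression

/-- The series of the coefficients along an arithmetic progression. -/
def progression (a b : ℕ) (g : ℤ⟦X⟧) : ℤ⟦X⟧ := PowerSeries.mk fun n => coeff (a * n + b) g

theorem coeff_progression (a b n : ℕ) (g : ℤ⟦X⟧) :
    coeff n (progression a b g) = coeff (a * n + b) g :=
  coeff_mk n fun n => coeff (a * n + b) g

theorem progression_progression (a b a' b' : ℕ) (g : ℤ⟦X⟧) :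
    progression a b (progression a' b' g) = progression (a' * a) (a' * b + b') g := by
  ext n
  simp only [coeff_progression]
  congr 2
  ring

/-- Here and in the next two lemmas, residues 2, 1, 0 correspond to multiplication by q, q^2, q^3
before U; the remaining X on the right avoids division by q. -/
theorem extractThree_X_mul (g : ℤ⟦X⟧) : extractThree (X * g) = X * progression 3 2 g := by
  ext n
  rw [coeff_extractThree]
  rcases n with _ | n
  · simp
  · rw [show 3 * (n + 1) = 3 * n + 2 + 1 by ring, coeff_succ_X_mul, coeff_succ_X_mul,
      coeff_progression]

theorem extractThree_X_mul_X_mul (g : ℤ⟦X⟧) :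
    extractThree (X * (X * g)) = X * progression 3 1 g := by
  ext n
  rw [coeff_extractThree]
  rcases n with _ | n
  · simp
  · rw [show 3 * (n + 1) = 3 * n + 1 + 1 + 1 by ring, coeff_succ_X_mul, coeff_succ_X_mul,
      coeff_succ_X_mul, coeff_progression]

theorem extractThree_X_cube_mul (g : ℤ⟦X⟧) :
    extractThree (X ^ 3 * g) = X * progression 3 0 g := by
  rw [← cubeSubst_X, extractThree_cubeSubst_mul]
  congr 1

theorem cubeSubst_iterate (k : ℕ) (g : ℤ⟦X⟧) :
    expand (3 ^ k) (pow_ne_zero k three_ne_zero) g = cubeSubst^[k] g := by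
  induction k with
  | zero => simp
  | succ k ih =>
    rw [Function.iterate_succ_apply', ← ih, cubeSubst_apply, ← expand_mul]
    congr! 2
    exact pow_succ' 3 k

theorem cubeSubst_cubeSubst_cancel :
    cubeSubst eulerProdThree ^ 3 * cubeSubst partitionSeriesThree ^ 3 = 1 := by
  rw [← mul_pow, ← map_mul, mul_comm, cubeSubst_partition_mul, map_one, one_pow]

theorem X_mul_partitionSeries_cube :
    X * partitionSeries ^ 3 = hauptNine * cubeSubst (partitionSeriesThree ^ 3) := by
  rw [hauptNine, map_pow]
  linear_combination (-X * partitionSeries ^ 3) * cubeSubst_cubeSubst_cancel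

theorem progression_start (h : ℤ⟦X⟧) :
    X * progression 3 2 (partitionSeries ^ 3 * cubeSubst h) =
      9 * hauptThree * (partitionSeriesThree ^ 3 * h) := by
  rw [← extractThree_X_mul, ← mul_assoc, X_mul_partitionSeries_cube,
    show hauptNine * cubeSubst (partitionSeriesThree ^ 3) * cubeSubst h =
      cubeSubst (partitionSeriesThree ^ 3 * h) * hauptNine by rw [map_mul]; ring,
    extractThree_cubeSubst_mul, extractThree_hauptNine]
  ring

/-- 9n + 5 = 3(3n + 1) + 2. The section 3n + 2 is a plain U (gain 2); the section 3n + 1 meets one q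
P^3, hence one factor s (gain 1). -/
theorem progression_nine_five {v : ℕ} {y D h : ℤ⟦X⟧} (hy : y ∈ slopeLattice v)
    (hD : X * D = y * (partitionSeriesThree ^ 3 * cubeSubst (cubeSubst h))) :
    ∃ z ∈ slopeLattice (v + 3), X * progression 9 5 D = z * (partitionSeriesThree ^ 3 * h) := by
  have h1 : X * progression 3 2 D = extractThree y * (partitionSeries ^ 3 * cubeSubst h) := by
    rw [← extractThree_X_mul, hD, show y * (partitionSeriesThree ^ 3 * cubeSubst (cubeSubst h)) =
      cubeSubst (partitionSeries ^ 3 * cubeSubst h) * y by rw [map_mul, map_pow]; ring,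
      extractThree_cubeSubst_mul]
    ring
  have m1 : extractThree y ∈ slopeLattice (v + 2) := by
    simpa using extractThree_mul_hauptNine_pow_mem (r := 0) (by norm_num) hy
  have m2 := extractThree_mul_hauptNine_pow_mem (r := 1) (by norm_num) m1
  rw [show v + 2 + 2 - 1 = v + 3 by omega, pow_one] at m2
  refine ⟨_, m2, ?_⟩
  rw [show progression 9 5 D = progression 3 1 (progression 3 2 D) by
      rw [progression_progression], ← extractThree_X_mul_X_mul, h1,
    show X * (extractThree y * (partitionSeries ^ 3 * cubeSubst h)) =
      cubeSubst (partitionSeriesThree ^ 3 * h) * (extractThree y * hauptNine) by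
        rw [map_mul]
        linear_combination (extractThree y * cubeSubst h) * X_mul_partitionSeries_cube,
    extractThree_cubeSubst_mul]
  ring

theorem progression_three_two {v : ℕ} {y D : ℤ⟦X⟧} (hy : y ∈ slopeLattice v)
    (hD : X * D = y * partitionSeriesThree ^ 6) :
    ∃ z ∈ slopeLattice (v + 2), X * progression 3 2 D = z * partitionSeries ^ 6 := by
  refine ⟨extractThree y, by
    simpa using extractThree_mul_hauptNine_pow_mem (r := 0) (by norm_num) hy, ?_⟩
  rw [← extractThree_X_mul, hD, show y * partitionSeriesThree ^ 6 =
    cubeSubst (partitionSeries ^ 6) * y by rw [map_pow]; ring, extractThree_cubeSubst_mul]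
  ring

/-- 9n + 2 = 3(3n) + 2. The second section meets (q P^3)^2, hence s^2, and gains nothing. -/
theorem progression_nine_two {v : ℕ} {y D : ℤ⟦X⟧} (hy : y ∈ slopeLattice v)
    (hD : X * D = y * partitionSeriesThree ^ 6) :
    ∃ z ∈ slopeLattice (v + 2), X * progression 9 2 D = z * partitionSeriesThree ^ 6 := by
  obtain ⟨y1, m1, h1⟩ := progression_three_two hy hD
  have m2 := extractThree_mul_hauptNine_pow_mem (r := 2) le_rfl m1
  rw [Nat.add_sub_cancel] at m2
  refine ⟨_, m2, ?_⟩
  rw [show progression 9 2 D = progression 3 0 (progression 3 2 D) by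
      rw [progression_progression], ← extractThree_X_cube_mul,
    show X ^ 3 * progression 3 2 D =
      cubeSubst (partitionSeriesThree ^ 6) * (y1 * hauptNine ^ 2) by
        have h2 := X_mul_partitionSeries_cube
        rw [map_pow] at h2 ⊢
        linear_combination X ^ 2 * h1 + y1 * (X * partitionSeries ^ 3 +
          hauptNine * cubeSubst partitionSeriesThree ^ 3) * h2,
    extractThree_cubeSubst_mul]
  ring

/-- Each step undoes two substitutions q ↦ q^3 in the second factor; after α steps one remains, and
both factors have become P(q^3)^3. -/
theorem progression_nine_pow_five (α : ℕ) {v : ℕ} {y D : ℤ⟦X⟧} (hy : y ∈ slopeLattice v)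
    (hD : X * D = y * (partitionSeriesThree ^ 3 * cubeSubst^[2 * α + 1] (partitionSeries ^ 3))) :
    ∃ t, 8 * t + 5 = 5 * 9 ^ α ∧ ∃ z ∈ slopeLattice (v + 3 * α),
      X * progression (9 ^ α) t D = z * partitionSeriesThree ^ 6 := by
  induction α generalizing v y D with
  | zero =>
    refine ⟨0, by norm_num, y, hy, ?_⟩
    have : progression (9 ^ 0) 0 D = D := by
      ext n
      rw [coeff_progression]
      simp
    rw [this, hD]
    simp only [mul_zero, zero_add, Function.iterate_one, map_pow]
    ring
  | succ α ih =>
    rw [show 2 * (α + 1) + 1 = 2 * α + 1 + 1 + 1 by ring, Function.iterate_succ_apply',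
      Function.iterate_succ_apply'] at hD
    obtain ⟨y', hy', hD'⟩ := progression_nine_five hy hD
    obtain ⟨t, ht, z, hz, h⟩ := ih hy' hD'
    rw [progression_progression] at h
    refine ⟨9 * t + 5, by rw [pow_succ]; omega, z, ?_, ?_⟩
    · rwa [show v + 3 * (α + 1) = v + 3 + 3 * α by ring]
    · rwa [pow_succ']

theorem progression_nine_pow_two (β : ℕ) {v : ℕ} {y D : ℤ⟦X⟧} (hy : y ∈ slopeLattice v)
    (hD : X * D = y * partitionSeriesThree ^ 6) :
    ∃ t, 8 * t + 2 = 2 * 9 ^ β ∧ ∃ z ∈ slopeLattice (v + 2 * β),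
      X * progression (9 ^ β) t D = z * partitionSeriesThree ^ 6 := by
  induction β generalizing v y D with
  | zero =>
    refine ⟨0, by norm_num, y, hy, ?_⟩
    have : progression (9 ^ 0) 0 D = D := by
      ext n
      rw [coeff_progression]
      simp
    rw [this, hD]
  | succ β ih =>
    obtain ⟨y', hy', hD'⟩ := progression_nine_two hy hD
    obtain ⟨t, ht, z, hz, h⟩ := ih hy' hD'
    rw [progression_progression] at h
    refine ⟨9 * t + 2, by rw [pow_succ]; omega, z, ?_, ?_⟩
    · rwa [show v + 2 * (β + 1) = v + 2 + 2 * β by ring]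
    · rwa [pow_succ']

/-- The counting series of two-color partition triples along the progressions considered. -/
theorem exists_progression_twoColor (α β : ℕ) :
    ∃ t, 8 * t = 2 * 3 ^ (2 * α + 2 * β + 1) + 3 ^ (2 * α + 2) + 1 ∧
      ∃ z ∈ slopeLattice (3 * α + 2 * β + 2),
        X * progression (3 ^ (2 * α + 2 * β + 1)) t (PowerSeries.mk fun n =>
          (twoColorPartitionTripleCount (3 ^ (2 * α + 2)) n : ℤ)) =
        z * partitionSeriesThree ^ 6 := by
  rw [mk_twoColorPartitionTripleCount (pow_ne_zero _ three_ne_zero), cubeSubst_iterate,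
    ← iterate_map_pow, show 2 * α + 2 = 2 * α + 1 + 1 by ring, Function.iterate_succ_apply']
  have h0 := progression_start (cubeSubst^[2 * α + 1] (partitionSeries ^ 3))
  have m0 : 9 * hauptThree ∈ slopeLattice 2 := by
    rw [show 9 * hauptThree = 3 ^ 2 * hauptThree ^ (0 + 1) by ring]
    exact pow_mul_mem_hauptLattice (by norm_num)
  obtain ⟨t₁, ht₁, y₁, m₁, h₁⟩ := progression_nine_pow_five α m0 h0
  obtain ⟨t₂, ht₂, y₂, m₂, h₂⟩ := progression_nine_pow_two β m₁ h₁
  rw [progression_progression, progression_progression] at h₂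
  have e1 : 3 ^ (2 * α + 2 * β + 1) = 3 * 9 ^ α * 9 ^ β := by
    rw [pow_succ, pow_add, pow_mul, pow_mul, show 3 ^ 2 = 9 from rfl]
    ring
  have e2 : 3 ^ (2 * α + 1 + 1) = 9 * 9 ^ α := by
    rw [show 2 * α + 1 + 1 = 2 * (α + 1) by ring, pow_mul, pow_succ, show 3 ^ 2 = 9 from rfl]
    ring
  refine ⟨3 * (9 ^ α * t₂ + t₁) + 2, ?_, y₂, ?_, ?_⟩
  · rw [e1, e2]
    linear_combination 3 * 9 ^ α * ht₂ + 3 * ht₁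
  · rwa [show 3 * α + 2 * β + 2 = 2 + 3 * α + 2 * β by ring]
  · rw [e1, mul_assoc]
    exact h₂

end Progression

/-! ### Extra powers of 3 from the leading terms. -/

theorem frobenius_cube (g : ℤ⟦X⟧) : ∃ w, g ^ 3 = cubeSubst g + 3 * w := by
  have : Fact (Nat.Prime 3) := ⟨Nat.prime_three⟩
  have h : PowerSeries.map (Int.castRingHom (ZMod 3)) (g ^ 3 - expand 3 three_ne_zero g) = 0 := by
    rw [map_sub, map_expand, map_pow, sub_eq_zero,
      ← MvPowerSeries.map_frobenius_expand 3 three_ne_zero, ZMod.frobenius_zmod]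
    exact congrFun (congrArg _ MvPowerSeries.map_id) _
  refine ⟨PowerSeries.mk fun n => coeff n (g ^ 3 - expand 3 three_ne_zero g) / 3, ?_⟩
  rw [cubeSubst_apply, ← sub_eq_iff_eq_add']
  ext n
  rw [show (3 : ℤ⟦X⟧) = C 3 by simp, coeff_C_mul, coeff_mk]
  have h2 := congrArg (coeff n) h
  rw [coeff_map, map_zero, eq_intCast, ZMod.intCast_zmod_eq_zero_iff_dvd] at h2
  exact (Int.mul_ediv_cancel' h2).symm

theorem coeff_three_pow_mul (m n : ℕ) (w : ℤ⟦X⟧) :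
    coeff n (3 ^ m * w) = 3 ^ m * coeff n w := by
  rw [show (3 : ℤ⟦X⟧) ^ m = C (3 ^ m) by simp, coeff_C_mul]

theorem coeff_intCast_mul (c : ℤ) (n : ℕ) (w : ℤ⟦X⟧) :
    coeff n ((c : ℤ⟦X⟧) * w) = c * coeff n w := by
  rw [show (c : ℤ⟦X⟧) = C c by simp, coeff_C_mul]

theorem exists_partitionSeries_cube_dissection : ∃ a b c : ℤ⟦X⟧,
    partitionSeries ^ 3 = cubeSubst a + 3 * (X * cubeSubst b) + 9 * (X ^ 2 * cubeSubst c) := by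
  obtain ⟨A, D, -, -, h, -⟩ := exists_partitionSeries_cube_eq
  refine ⟨A ^ 2 * D, A * eulerProdThree ^ 3 * D, eulerProdThree ^ 6 * D, ?_⟩
  rw [h]
  simp only [map_mul, map_pow]
  ring

theorem euler_mul_partition_three_pow (k : ℕ) :
    eulerProdThree ^ k * partitionSeriesThree ^ k = 1 := by
  rw [← mul_pow, mul_comm, cubeSubst_partition_mul, one_pow]

theorem euler_mul_partition_pow (k : ℕ) : partitionSeries ^ k * eulerProd ^ k = 1 := by
  rw [← mul_pow, partitionSeries_mul_eulerProd, one_pow]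

theorem three_pow_dvd_coeff {v : ℕ} {y D : ℤ⟦X⟧} (hy : y ∈ slopeLattice v)
    (hD : X * D = y * partitionSeriesThree ^ 6) (n : ℕ) : (3 : ℤ) ^ v ∣ coeff n D := by
  obtain ⟨c, d, w, rfl⟩ := exists_eq_of_mem_slopeLattice hy
  rw [← coeff_succ_X_mul, hD, mul_assoc, coeff_three_pow_mul]
  exact dvd_mul_right _ _

/-- Mod 3, P^12 = (P^3)^4 is a series in q^3, so x P(q^3)^6 is q times such a series; the terms from
x^2 on already carry 9. -/
theorem three_pow_dvd_coeff_three_mul_add_one {v : ℕ} {y D : ℤ⟦X⟧} (hy : y ∈ slopeLattice v)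
    (hD : X * D = y * partitionSeriesThree ^ 6) (n : ℕ) :
    (3 : ℤ) ^ (v + 1) ∣ coeff (3 * n + 1) D := by
  obtain ⟨c, d, w, rfl⟩ := exists_eq_of_mem_slopeLattice hy
  obtain ⟨a, b, e, h⟩ := exists_partitionSeries_cube_dissection
  obtain ⟨u, hu⟩ : ∃ u, hauptThree * partitionSeriesThree ^ 6 =
      X * cubeSubst (eulerProd ^ 12 * partitionSeries ^ 6 * a ^ 4) + 3 * u := by
    have h1 : ∃ u, partitionSeries ^ 12 = cubeSubst a ^ 4 + 3 * u := by
      rw [show partitionSeries ^ 12 = (partitionSeries ^ 3) ^ 4 by ring, h,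
        show cubeSubst a + 3 * (X * cubeSubst b) + 9 * (X ^ 2 * cubeSubst e) =
          cubeSubst a + 3 * (X * cubeSubst b + 3 * (X ^ 2 * cubeSubst e)) by ring]
      generalize X * cubeSubst b + 3 * (X ^ 2 * cubeSubst e) = z
      exact ⟨4 * cubeSubst a ^ 3 * z + 18 * cubeSubst a ^ 2 * z ^ 2 + 36 * cubeSubst a * z ^ 3 +
        27 * z ^ 4, by ring⟩
    obtain ⟨u, hu⟩ := h1
    refine ⟨X * eulerProdThree ^ 12 * partitionSeriesThree ^ 6 * u, ?_⟩
    rw [hauptThree, hu]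
    simp only [map_mul, map_pow]
    ring
  have key : X * D = 3 ^ v * ((c : ℤ⟦X⟧) * (X * cubeSubst (eulerProd ^ 12 * partitionSeries ^ 6 * a ^ 4)) +
      3 ^ 1 * ((c : ℤ⟦X⟧) * u + (3 * (d : ℤ⟦X⟧) * hauptThree ^ 2 + 27 * w) * partitionSeriesThree ^ 6)) := by
    rw [hD]
    linear_combination 3 ^ v * (c : ℤ⟦X⟧) * hu
  rw [← coeff_succ_X_mul, key, coeff_three_pow_mul, map_add, coeff_intCast_mul, coeff_succ_X_mul,
    coeff_cubeSubst_of_not_dvd _ (by omega), mul_zero, zero_add, coeff_three_pow_mul, ← mul_assoc,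
    ← pow_add]
  exact dvd_mul_right _ _

/-- E^3 ≡ E(q^3) mod 3 gives E^18 ≡ E(q^3)^6 mod 9 on taking sixth powers, hence x P(q^3)^6 = q
E(q^3)^6 P^12 ≡ q E^6 mod 9. -/
theorem three_pow_dvd_coeff_of_coeff_euler {v : ℕ} {y D : ℤ⟦X⟧} (hy : y ∈ slopeLattice v)
    (hD : X * D = y * partitionSeriesThree ^ 6) {N : ℕ} (hN : coeff N (eulerProd ^ 6) = 0) :
    (3 : ℤ) ^ (v + 2) ∣ coeff N D := by
  obtain ⟨c, d, w, rfl⟩ := exists_eq_of_mem_slopeLattice hy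
  obtain ⟨u, hu⟩ : ∃ u, hauptThree * partitionSeriesThree ^ 6 = X * eulerProd ^ 6 + 9 * u := by
    obtain ⟨w₁, h1⟩ := frobenius_cube eulerProd
    obtain ⟨w₂, h2⟩ : ∃ w₂, eulerProd ^ 18 = eulerProdThree ^ 6 + 9 * w₂ := by
      rw [show eulerProd ^ 18 = (eulerProd ^ 3) ^ 6 by ring, h1]
      exact ⟨2 * eulerProdThree ^ 5 * w₁ + 15 * eulerProdThree ^ 4 * w₁ ^ 2 +
        60 * eulerProdThree ^ 3 * w₁ ^ 3 + 135 * eulerProdThree ^ 2 * w₁ ^ 4 +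
        162 * eulerProdThree * w₁ ^ 5 + 81 * w₁ ^ 6, by ring⟩
    refine ⟨-X * partitionSeries ^ 12 * w₂, ?_⟩
    have h3 := euler_mul_partition_three_pow 6
    have h4 := euler_mul_partition_pow 12
    rw [hauptThree]
    linear_combination X * eulerProdThree ^ 6 * partitionSeries ^ 12 * h3 +
      X * eulerProd ^ 6 * h4 - X * partitionSeries ^ 12 * h2
  have key : X * D = 3 ^ v * ((c : ℤ⟦X⟧) * (X * eulerProd ^ 6) +
      3 ^ 2 * ((c : ℤ⟦X⟧) * u + ((d : ℤ⟦X⟧) * hauptThree ^ 2 + 9 * w) * partitionSeriesThree ^ 6)) := by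
    rw [hD]
    linear_combination 3 ^ v * (c : ℤ⟦X⟧) * hu
  rw [← coeff_succ_X_mul, key, coeff_three_pow_mul, map_add, coeff_intCast_mul, coeff_succ_X_mul,
    hN, mul_zero, zero_add, coeff_three_pow_mul, ← mul_assoc, ← pow_add]
  exact dvd_mul_right _ _

/-- P^18 = (P^3)^6 is a series in q^3 up to a term 9q·(series in q^3) mod 27, and P^30 is a series
in q^3 mod 3. So mod 27 the class of q^1 is unrestricted, that of q^2 carries 9, and that of q^0
vanishes. -/
theorem exists_eq_of_even_stage {v : ℕ} {y D : ℤ⟦X⟧} (hy : y ∈ slopeLattice v)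
    (hD : X * D = y * partitionSeries ^ 6) : ∃ (c d : ℤ) (f g h w : ℤ⟦X⟧),
      X * D = 3 ^ v * ((c : ℤ⟦X⟧) * (X * cubeSubst f) + 3 ^ 2 * ((c : ℤ⟦X⟧) * (X * (X * cubeSubst g)) +
        (d : ℤ⟦X⟧) * (X * (X * cubeSubst h)) + 3 ^ 1 * w)) := by
  obtain ⟨c, d, w, rfl⟩ := exists_eq_of_mem_slopeLattice hy
  obtain ⟨a, b, e, h⟩ := exists_partitionSeries_cube_dissection
  obtain ⟨u₁, h1⟩ : ∃ u, partitionSeries ^ 18 =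
      cubeSubst (a ^ 6) + 9 * (X * cubeSubst (2 * a ^ 5 * b)) + 27 * u := by
    rw [show partitionSeries ^ 18 = (partitionSeries ^ 3) ^ 6 by ring, h]
    simp only [map_mul, map_pow, map_ofNat]
    exact ⟨2 * cubeSubst a ^ 5 * (X ^ 2 * cubeSubst e) +
      5 * cubeSubst a ^ 4 * (X * cubeSubst b + 3 * (X ^ 2 * cubeSubst e)) ^ 2 +
      20 * cubeSubst a ^ 3 * (X * cubeSubst b + 3 * (X ^ 2 * cubeSubst e)) ^ 3 +
      45 * cubeSubst a ^ 2 * (X * cubeSubst b + 3 * (X ^ 2 * cubeSubst e)) ^ 4 +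
      54 * cubeSubst a * (X * cubeSubst b + 3 * (X ^ 2 * cubeSubst e)) ^ 5 +
      27 * (X * cubeSubst b + 3 * (X ^ 2 * cubeSubst e)) ^ 6, by ring⟩
  obtain ⟨u₂, h2⟩ : ∃ u, partitionSeries ^ 30 = cubeSubst (a ^ 10) + 3 * u := by
    rw [show partitionSeries ^ 30 = (partitionSeries ^ 3) ^ 10 by ring, h,
        show cubeSubst a + 3 * (X * cubeSubst b) + 9 * (X ^ 2 * cubeSubst e) =
          cubeSubst a + 3 * (X * cubeSubst b + 3 * (X ^ 2 * cubeSubst e)) by ring, map_pow]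
    generalize X * cubeSubst b + 3 * (X ^ 2 * cubeSubst e) = z
    obtain ⟨k, hk⟩ := sub_dvd_pow_sub_pow (cubeSubst a + 3 * z) (cubeSubst a) 10
    exact ⟨z * k, by linear_combination hk⟩
  refine ⟨c, d, eulerProd ^ 12 * a ^ 6, eulerProd ^ 12 * (2 * a ^ 5 * b), eulerProd ^ 24 * a ^ 10,
    (c : ℤ⟦X⟧) * X * eulerProdThree ^ 12 * u₁ + (d : ℤ⟦X⟧) * X ^ 2 * eulerProdThree ^ 24 * u₂ +
      3 * w * partitionSeries ^ 6, ?_⟩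
  rw [hD, hauptThree]
  simp only [map_mul, map_pow, map_ofNat] at h1 h2 ⊢
  linear_combination 3 ^ v * (c : ℤ⟦X⟧) * X * cubeSubst eulerProd ^ 12 * h1 +
    3 ^ v * 9 * (d : ℤ⟦X⟧) * X ^ 2 * cubeSubst eulerProd ^ 24 * h2

theorem three_pow_dvd_coeff_even_add_one {v : ℕ} {y D : ℤ⟦X⟧} (hy : y ∈ slopeLattice v)
    (hD : X * D = y * partitionSeries ^ 6) (n : ℕ) :
    (3 : ℤ) ^ (v + 2) ∣ coeff (3 * n + 1) D := by
  obtain ⟨c, d, f, g, h, w, key⟩ := exists_eq_of_even_stage hy hD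
  rw [← coeff_succ_X_mul, key, coeff_three_pow_mul, map_add, coeff_intCast_mul, coeff_succ_X_mul,
    coeff_cubeSubst_of_not_dvd _ (by omega), mul_zero, zero_add, coeff_three_pow_mul, ← mul_assoc,
    ← pow_add]
  exact dvd_mul_right _ _

theorem three_pow_dvd_coeff_even_add_two {v : ℕ} {y D : ℤ⟦X⟧} (hy : y ∈ slopeLattice v)
    (hD : X * D = y * partitionSeries ^ 6) (n : ℕ) :
    (3 : ℤ) ^ (v + 3) ∣ coeff (3 * n + 2) D := by
  obtain ⟨c, d, f, g, h, w, key⟩ := exists_eq_of_even_stage hy hD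
  rw [← coeff_succ_X_mul, key, coeff_three_pow_mul, map_add, coeff_intCast_mul, coeff_succ_X_mul,
    coeff_cubeSubst_of_not_dvd _ (by omega), mul_zero, zero_add, coeff_three_pow_mul, map_add,
    map_add, coeff_intCast_mul, coeff_intCast_mul, coeff_succ_X_mul, coeff_succ_X_mul,
    coeff_succ_X_mul, coeff_succ_X_mul, coeff_cubeSubst_of_not_dvd _ (by omega),
    coeff_cubeSubst_of_not_dvd _ (by omega), mul_zero, mul_zero, zero_add, zero_add,
    coeff_three_pow_mul, ← mul_assoc, ← mul_assoc, ← pow_add, ← pow_add]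
  exact dvd_mul_right _ _

/-! ### The five congruences. -/

theorem modEq_zero_of_dvd_coeff {ℓ a t m N n : ℕ} {D : ℤ⟦X⟧}
    (hD : D = progression a t (PowerSeries.mk fun n => (twoColorPartitionTripleCount ℓ n : ℤ)))
    (h : (3 : ℤ) ^ m ∣ coeff N D) (hn : n = a * N + t) :
    twoColorPartitionTripleCount ℓ n ≡ 0 [MOD 3 ^ m] := by
  rw [hD, coeff_progression, coeff_mk, ← hn] at h
  rw [Nat.modEq_zero_iff_dvd]
  exact_mod_cast h

/-- All the divisions by `8` in `ℕ` below are exact. -/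
theorem theorem1p6 (α β : ℕ) :
    (∀ n : ℕ, twoColorPartitionTripleCount (3 ^ (2 * α + 2))
        (3 ^ (2 * α + 2 * β + 1) * n
          + (2 * 3 ^ (2 * α + 2 * β + 1) + 3 ^ (2 * α + 2) + 1) / 8)
      ≡ 0 [MOD 3 ^ (3 * α + 2 * β + 2)]) ∧
    (∀ n : ℕ, twoColorPartitionTripleCount (3 ^ (2 * α + 2))
        (3 ^ (2 * α + 2 * β + 2) * n
          + (10 * 3 ^ (2 * α + 2 * β + 1) + 3 ^ (2 * α + 2) + 1) / 8)
      ≡ 0 [MOD 3 ^ (3 * α + 2 * β + 3)]) ∧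
    (∀ n : ℕ, twoColorPartitionTripleCount (3 ^ (2 * α + 2))
        (3 ^ (2 * α + 2 * β + 3) * n
          + (14 * 3 ^ (2 * α + 2 * β + 2) + 3 ^ (2 * α + 2) + 1) / 8)
      ≡ 0 [MOD 3 ^ (3 * α + 2 * β + 6)]) ∧
    (∀ n : ℕ, twoColorPartitionTripleCount (3 ^ (2 * α + 2))
        (3 ^ (2 * α + 2 * β + 3) * n
          + (22 * 3 ^ (2 * α + 2 * β + 2) + 3 ^ (2 * α + 2) + 1) / 8)
      ≡ 0 [MOD 3 ^ (3 * α + 2 * β + 7)]) ∧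
    (∀ n k p : ℕ, p.Prime → p ≡ 3 [MOD 4] → ¬ p ∣ n →
      twoColorPartitionTripleCount (3 ^ (2 * α + 2))
        (3 ^ (2 * α + 2 * β + 1) * p ^ (2 * k + 1) * n
          + (2 * p ^ (2 * k + 2) * 3 ^ (2 * α + 2 * β + 1) + 3 ^ (2 * α + 2) + 1) / 8)
      ≡ 0 [MOD 3 ^ (3 * α + 2 * β + 4)]) := by
  obtain ⟨t, ht, y, hy, hD⟩ := exists_progression_twoColor α β
  set D := progression (3 ^ (2 * α + 2 * β + 1)) t (PowerSeries.mk fun n =>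
    (twoColorPartitionTripleCount (3 ^ (2 * α + 2)) n : ℤ)) with hDdef
  obtain ⟨z, hz, hE⟩ := progression_three_two hy hD
  have e2 : 3 ^ (2 * α + 2 * β + 2) = 3 * 3 ^ (2 * α + 2 * β + 1) := pow_succ' _ _
  have e3 : 3 ^ (2 * α + 2 * β + 3) = 9 * 3 ^ (2 * α + 2 * β + 1) := by
    rw [pow_succ', pow_succ' 3 (2 * α + 2 * β + 1)]
    ring
  refine ⟨fun n => ?_, fun n => ?_, fun n => ?_, fun n => ?_, fun n k p hp h4 hn => ?_⟩
  · refine modEq_zero_of_dvd_coeff hDdef (three_pow_dvd_coeff hy hD n) ?_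
    rw [← ht, Nat.mul_div_cancel_left _ (by norm_num)]
  · refine modEq_zero_of_dvd_coeff hDdef (three_pow_dvd_coeff_three_mul_add_one hy hD n) ?_
    rw [show 10 * 3 ^ (2 * α + 2 * β + 1) + 3 ^ (2 * α + 2) + 1 =
      8 * (3 ^ (2 * α + 2 * β + 1) + t) by rw [mul_add, ht]; ring,
      Nat.mul_div_cancel_left _ (by norm_num), e2]
    ring
  · have h := three_pow_dvd_coeff_even_add_one hz hE n
    rw [coeff_progression] at h
    refine modEq_zero_of_dvd_coeff hDdef h ?_
    rw [show 14 * 3 ^ (2 * α + 2 * β + 2) + 3 ^ (2 * α + 2) + 1 =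
      8 * (5 * 3 ^ (2 * α + 2 * β + 1) + t) by rw [mul_add, ht, e2]; ring,
      Nat.mul_div_cancel_left _ (by norm_num), e3]
    ring
  · have h := three_pow_dvd_coeff_even_add_two hz hE n
    rw [coeff_progression] at h
    refine modEq_zero_of_dvd_coeff hDdef h ?_
    rw [show 22 * 3 ^ (2 * α + 2 * β + 2) + 3 ^ (2 * α + 2) + 1 =
      8 * (8 * 3 ^ (2 * α + 2 * β + 1) + t) by rw [mul_add, ht, e2]; ring,
      Nat.mul_div_cancel_left _ (by norm_num), e3]
    ring
  · refine modEq_zero_of_dvd_coeff hDdef (three_pow_dvd_coeff_of_coeff_euler hy hD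
      (coeff_eulerProd_pow_six_eq_zero (k := k) hp h4 hn)) ?_
    have h4' : p % 4 = 3 := h4
    have h1 : p ^ (2 * k + 2) % 4 = 1 := by
      rw [show 2 * k + 2 = 2 * (k + 1) by ring, pow_mul, Nat.pow_mod, Nat.pow_mod p, h4']
      simp
    obtain ⟨u, hu⟩ : ∃ u, p ^ (2 * k + 2) = 4 * u + 1 := ⟨p ^ (2 * k + 2) / 4, by omega⟩
    rw [hu, Nat.add_sub_cancel, Nat.mul_div_cancel_left _ (by norm_num),
      show 2 * (4 * u + 1) * 3 ^ (2 * α + 2 * β + 1) + 3 ^ (2 * α + 2) + 1 =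
        8 * (3 ^ (2 * α + 2 * β + 1) * u + t) by rw [mul_add 8, ht]; ring,
      Nat.mul_div_cancel_left _ (by norm_num)]
    ring
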